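/- Let $N,d\ge 0$ be integers, let $I\subset\mathbb{R}^N$ be bounded, let $H\in(0,1]^N$, and put $$\rho(s,t)=\sum_{j=1}^N|s_j-t_j|^{H_j}\quad(s,t\in\mathbb{R}^N),\qquad Q=\sum_{j=1}^N \frac1{H_j}.$$ Let $X=(X(t))_{t\in I}$ be a centred Gaussian random field with values in $\mathbb{R}^d$, defined on a probability space $(\Omega,\mathcal{A},\mathbb{P})$, whose sample paths $t\mapsto X(t)$ are almost surely continuous on $I$. Let $\|\cdot\|$ be the Euclidean norm, and assume: (i) there is a constant $c>0$ such that $\sqrt{\mathbb{E}[\|X(s)-X(t)\|^2]}\le c\,\rho(s,t)$ for all $s,t\in I$; (ii) there is a constant $\lambda>0$ such that $\mathbb{E}\big[\big(\sum_{j=1}^d e_jX_j(t)\big)^2\big]\ge\lambda$ for all $t\in I$ and all $e\in\mathbb{R}^d$ with $\|e\|=1$. Suppose that $Q<d$, and let $\mathcal{H}_{d-Q}$ denote the $(d-Q)$-dimensional Hausdorff measure on $\mathbb{R}^d$. Then for each $L\ge0$ there is a constant $C>0$ such that $$\mathbb{P}\big(\exists s\in I:\ X(s)+Y(s)\in F\big)\le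 C\,\mathcal{H}_{d-Q}(F)$$ for all Borel sets $F\subseteq\mathbb{R}^d$ and all $\mathbb{R}^d$-valued random fields $Y=(Y(t))_{t\in I}$ on $(\Omega,\mathcal{A},\mathbb{P})$ that are independent of $X$ and all of whose sample paths satisfy $\|Y(s)-Y(t)\|\le L\,\rho(s,t)$ for all $s,t\in I$. In particular, every set $F\subseteq\mathbb{R}^d$ with $\mathcal{H}_{d-Q}(F)=0$ is polar for $X$, that is, almost surely there is no $s\in I$ with $X(s)\in F$. (Where an event is not measurable, $\mathbb{P}$ denotes the outer probability.) -/

import Mathlib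

open MeasureTheory ProbabilityTheory

/-- The anisotropic metric `ρ(s,t) = ∑ j, |s_j - t_j| ^ H_j` on `ℝ^N`. -/
noncomputable def anisoDist {N : ℕ} (H : Fin N → ℝ) (s t : EuclideanSpace ℝ (Fin N)) : ℝ :=
  ∑ j, |s j - t j| ^ H j

/-- The number `Q = ∑ j, 1 / H_j`. -/
noncomputable def anisoQ {N : ℕ} (H : Fin N → ℝ) : ℝ :=
  ∑ j, 1 / H j

/-- The functions `f : I → ℝ^d` with `‖f s - f t‖ ≤ L * ρ(s,t)` for all `s, t ∈ I`. -/
def lipAniso {N d : ℕ} (H : Fin N → ℝ) (I : Set (EuclideanSpace ℝ (Fin N))) (L : ℝ) :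
    Set (I → EuclideanSpace ℝ (Fin d)) :=
  {f | ∀ s t : I, ‖f s - f t‖ ≤ L * anisoDist H s t}

/-- A centred Gaussian random field indexed by `I ⊆ ℝ^N` with values in `ℝ^d`: a family of random
vectors all of whose finite-dimensional distributions are (jointly) Gaussian, with mean zero. -/
structure IsCentredGaussianField {N d : ℕ} {Ω : Type*} [MeasurableSpace Ω] (P : Measure Ω)
    {I : Set (EuclideanSpace ℝ (Fin N))} (X : I → Ω → EuclideanSpace ℝ (Fin d)) : Prop where
  measurable : ∀ t, Measurable (X t)
  gaussian : IsGaussianProcess X P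
  centred : ∀ t, ∫ ω, X t ω ∂P = 0

/-- The canonical metric `√E[‖X(s) - X(t)‖²]` is at most a constant times `ρ(s,t)`. -/
def CanonicalMetricDominated {N d : ℕ} {Ω : Type*} [MeasurableSpace Ω] (P : Measure Ω)
    (H : Fin N → ℝ) {I : Set (EuclideanSpace ℝ (Fin N))}
    (X : I → Ω → EuclideanSpace ℝ (Fin d)) : Prop :=
  ∃ c : ℝ, 0 < c ∧ ∀ s t : I,
    Real.sqrt (∫ ω, ‖X s ω - X t ω‖ ^ 2 ∂P) ≤ c * anisoDist H s t

/-- The eigenvalues of the covariance matrix of `X(t)` are bounded below by a positive constant,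
uniformly in `t`. -/
def CovarianceBoundedBelow {N d : ℕ} {Ω : Type*} [MeasurableSpace Ω] (P : Measure Ω)
    {I : Set (EuclideanSpace ℝ (Fin N))} (X : I → Ω → EuclideanSpace ℝ (Fin d)) : Prop :=
  ∃ lam : ℝ, 0 < lam ∧ ∀ t : I, ∀ e : EuclideanSpace ℝ (Fin d), ‖e‖ = 1 →
    lam ≤ ∫ ω, (∑ j, e j * X t ω j) ^ 2 ∂P

/-- `F` is polar for `X`: almost surely `X` does not hit `F`. (For an event that is not known to be
measurable, measure zero means being contained in a measurable set of measure zero.) -/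
def IsPolarFor {N d : ℕ} {Ω : Type*} [MeasurableSpace Ω] (P : Measure Ω)
    {I : Set (EuclideanSpace ℝ (Fin N))} (X : I → Ω → EuclideanSpace ℝ (Fin d))
    (F : Set (EuclideanSpace ℝ (Fin d))) : Prop :=
  P {ω | ∃ s : I, X s ω ∈ F} = 0

/-!
Cover `F` by sets of small diameter: by countable subadditivity, the theorem follows from the
estimate `P(X + Y hits a ball of radius r) ≤ C r ^ (d - Q)`, uniformly in the ball and in `Y`
(`measure_exists_mem_le_hausdorffMeasure`). The bounded index set is covered by `O(r ^ (-Q))`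
anisotropic boxes of radius `r`, so it suffices that a ball of radius `r` is hit from one such
box, centred at some `t₀ ∈ I`, with probability `O(r ^ d)`
(`exists_measure_hit_ball_from_box_le`).

For this, write `X s = ∑ i, ⟪b i, X t₀⟫ • c i s + Z s`, the linear regression of `X s` on `X t₀`
in an orthonormal basis `b` that diagonalises the covariance of `X t₀`. The residual process `Z`
is independent of `X t₀` (`indepFun_regressionResidual`), and the coefficients `c i` are Lipschitz
for `ρ`, since the canonical metric is dominated by `ρ` and the eigenvalues of the covariance are
bounded below. Hence, if `X + Y` comes within `r` of `x` at some point of the box, then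
`‖X t₀ + (Y t₀ - x)‖ ≤ (a r + w) (1 + ‖X t₀‖)`, where the constant `a` also absorbs the
oscillation of `Y`, and `w` bounds the oscillation of `Z` over the box (`norm_add_le_of_hit`).
The pair formed by `w` and `Y t₀` is independent of the nondegenerate Gaussian vector `X t₀`, so
that given this pair the inequality has probability at most `K (a r + w) ^ d`, whatever `Y t₀ - x`
is: this is the small-ball estimate `exists_measure_norm_add_le_mul_one_add_norm`, in which the
decay of the Gaussian density compensates the factor `1 + ‖X t₀‖`.

It remains that `w` has `d`-th moment `O(r ^ d)`. All moments of Gaussian increments are controlled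
by the second one, so chaining along nets of the box at the scales `r 4 ^ (-n)` applies
with a large exponent `p` in place of `d` (`exists_chaining_functional`). The resulting bound is a
measurable functional of countably many values of `Z`, which is what makes it independent of `X t₀`.
-/

/-! ### Gaussian small-ball and moment estimates -/

/-- The Gaussian density decays faster than any power, uniformly over variances bounded away from
zero and infinity. -/
theorem gaussianPDFReal_le_div_one_add_abs_pow (d : ℕ) {lam Lam : ℝ} (hlam : 0 < lam)
    {v : NNReal} (h₁ : lam ≤ v) (h₂ : (v : ℝ) ≤ Lam) (x : ℝ) :
    gaussianPDFReal 0 v x ≤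
      (√(2 * Real.pi * lam))⁻¹ * (d.factorial * Real.exp (1 + Lam / 2)) / (1 + |x|) ^ d := by
  have hv : (0 : ℝ) < v := hlam.trans_le h₁
  have hx : 0 < 1 + |x| := by positivity
  have key : Real.exp (-(x - 0) ^ 2 / (2 * v)) * (1 + |x|) ^ d ≤
      d.factorial * Real.exp (1 + Lam / 2) := by
    have h3 := Real.pow_div_factorial_le_exp (1 + |x|) hx.le d
    rw [div_le_iff₀ (by positivity)] at h3
    have h4 : |x| ≤ x ^ 2 / (2 * v) + v / 2 := by
      have : x ^ 2 / (2 * v) + v / 2 - |x| = (|x| - v) ^ 2 / (2 * v) := by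
        rw [← sq_abs x]; field_simp; ring
      have h5 : 0 ≤ (|x| - v) ^ 2 / (2 * v) := by positivity
      linarith
    calc _ ≤ Real.exp (-(x - 0) ^ 2 / (2 * v)) * (Real.exp (1 + |x|) * d.factorial) := by gcongr
      _ = d.factorial * Real.exp (-x ^ 2 / (2 * v) + (1 + |x|)) := by
          rw [Real.exp_add (-x ^ 2 / (2 * v)), sub_zero]; ring
      _ ≤ _ := by
          have h5 : -x ^ 2 / (2 * v) + (1 + |x|) ≤ 1 + Lam / 2 := by
            rw [neg_div]
            linarith
          gcongr
  rw [le_div_iff₀ (by positivity), gaussianPDFReal, mul_assoc]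
  gcongr

theorem measure_abs_add_le_of_pdf_le {Ω : Type*} [MeasurableSpace Ω] {P : Measure Ω}
    {S : Ω → ℝ} (hS : Measurable S) {v : NNReal} (hv : v ≠ 0)
    (hlaw : P.map S = gaussianReal 0 v) {a R M : ℝ} (hM : 0 ≤ M)
    (h : ∀ x, |x + a| ≤ R → gaussianPDFReal 0 v x ≤ M) :
    P (S ⁻¹' {x | |x + a| ≤ R}) ≤ ENNReal.ofReal (2 * R * M) := by
  have hset : {x : ℝ | |x + a| ≤ R} = Set.Icc (-a - R) (-a + R) := by
    ext x
    simp only [Set.mem_ofPred_eq, Set.mem_Icc, abs_le]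
    constructor <;> rintro ⟨h1, h2⟩ <;> constructor <;> linarith
  have hmeas : MeasurableSet {x : ℝ | |x + a| ≤ R} := hset ▸ measurableSet_Icc
  rw [← Measure.map_apply hS hmeas, hlaw, gaussianReal_apply _ hv]
  calc ∫⁻ x in {x | |x + a| ≤ R}, gaussianPDF 0 v x
      ≤ ∫⁻ _ in {x | |x + a| ≤ R}, ENNReal.ofReal M :=
        setLIntegral_mono' hmeas fun x hx => ENNReal.ofReal_le_ofReal (h x hx)
    _ = ENNReal.ofReal (2 * R * M) := by
        rw [setLIntegral_const, hset, Real.volume_Icc, ← ENNReal.ofReal_mul hM]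
        congr 1; ring

/-- Small-ball estimate for a nondegenerate Gaussian vector. The radius of the ball is allowed to
grow linearly with the vector; the rapid decay of the Gaussian density makes the estimate uniform
in the centre. -/
theorem exists_measure_norm_add_le_mul_one_add_norm {Ω : Type*} [MeasurableSpace Ω]
    (P : Measure Ω) [IsProbabilityMeasure P] {d : ℕ} (hd : 0 < d) {lam Lam : ℝ} (hlam : 0 < lam) :
    ∃ K : ℝ, 0 < K ∧ ∀ (b : OrthonormalBasis (Fin d) ℝ (EuclideanSpace ℝ (Fin d)))
      (G : Ω → EuclideanSpace ℝ (Fin d)) (v : Fin d → NNReal),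
      (∀ i, lam ≤ v i ∧ (v i : ℝ) ≤ Lam) → Measurable G →
      (∀ i, P.map (fun ω => inner ℝ (b i) (G ω)) = gaussianReal 0 (v i)) →
      iIndepFun (fun i ω => inner ℝ (b i) (G ω)) P →
      ∀ (y : EuclideanSpace ℝ (Fin d)) (η : ℝ), 0 ≤ η →
        P {ω | ‖G ω + y‖ ≤ η * (1 + ‖G ω‖)} ≤ ENNReal.ofReal (K * η ^ d) := by
  have hd1 : (1 : ℝ) ≤ d := by exact_mod_cast hd
  set M : ℝ := (√(2 * Real.pi * lam))⁻¹ * (d.factorial * Real.exp (1 + Lam / 2)) with hMdef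
  have hM : 0 < M := by positivity
  refine ⟨(8 * d * (1 + M)) ^ d, by positivity, fun b G v hv hG hlaw hind y η hη => ?_⟩
  rw [← mul_pow]
  have hv0 : ∀ i, v i ≠ 0 := fun i h => by
    have := (hv i).1; rw [h] at this; simp at this; linarith
  by_cases hη1 : 1 < 8 * d * η
  · -- For large `η` the right-hand side exceeds `1`.
    refine prob_le_one.trans ?_
    rw [← ENNReal.ofReal_one]
    refine ENNReal.ofReal_le_ofReal (one_le_pow₀ ?_)
    nlinarith [mul_pos hM (by linarith : 0 < 8 * d * η)]
  push Not at hη1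
  have hη8 : η ≤ 1 / 8 := by nlinarith
  set R : ℝ := 2 * η * (1 + ‖y‖) with hR
  have hR0 : 0 ≤ R := by positivity
  obtain ⟨i, -, hi⟩ := Finset.exists_max_image Finset.univ (fun k => |inner ℝ (b k) y|)
    ⟨⟨0, hd⟩, Finset.mem_univ _⟩
  have hnorm : ‖y‖ ≤ d * |inner ℝ (b i) y| := by
    conv_lhs => rw [← b.sum_repr' y]
    refine (norm_sum_le _ _).trans ?_
    calc _ ≤ ∑ _k : Fin d, |inner ℝ (b i) y| := by
          refine Finset.sum_le_sum fun k _ => ?_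
          rw [norm_smul, b.norm_eq_one, mul_one, Real.norm_eq_abs]
          exact hi k (Finset.mem_univ _)
      _ = _ := by simp
  set a : Fin d → ℝ := fun k => inner ℝ (b k) y with ha
  have h1y : 1 + ‖y‖ ≤ d * (1 + |a i|) := by
    have : ‖y‖ ≤ d * |a i| := hnorm
    nlinarith
  have hR4 : R ≤ (1 + |a i|) / 4 := by
    calc R ≤ 2 * η * (d * (1 + |a i|)) := by rw [hR]; gcongr
      _ = (8 * d * η) * ((1 + |a i|) / 4) := by ring
      _ ≤ 1 * ((1 + |a i|) / 4) := by gcongr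
      _ = _ := one_mul _
  have hsub : {ω | ‖G ω + y‖ ≤ η * (1 + ‖G ω‖)} ⊆
      ⋂ k ∈ Finset.univ, (fun ω => inner ℝ (b k) (G ω)) ⁻¹' {x | |x + a k| ≤ R} := by
    intro ω hω
    simp only [Set.mem_ofPred_eq] at hω
    simp only [Finset.mem_univ, Set.iInter_true, Set.mem_iInter, Set.mem_preimage,
      Set.mem_ofPred_eq]
    intro k
    have h1 : ‖G ω‖ ≤ ‖G ω + y‖ + ‖y‖ := by
      simpa using norm_sub_le (G ω + y) y
    have h2 : ‖G ω + y‖ ≤ R := by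
      have h3 : 1 + ‖G ω‖ ≤ 2 * (1 + ‖y‖) := by
        nlinarith [norm_nonneg (G ω), norm_nonneg y]
      calc _ ≤ η * (1 + ‖G ω‖) := hω
        _ ≤ η * (2 * (1 + ‖y‖)) := by gcongr
        _ = R := by rw [hR]; ring
    rw [ha, ← inner_add_right]
    refine (abs_real_inner_le_norm _ _).trans ?_
    rwa [b.norm_eq_one, one_mul]
  set w : ℝ := (2 * d) ^ d / (1 + ‖y‖) ^ d with hw
  have hpdf := fun k => gaussianPDFReal_le_div_one_add_abs_pow d hlam (hv k).1 (hv k).2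
  -- Only the largest coordinate of `y` is used to gain the factor `(1 + ‖y‖) ^ (-d)`.
  have hbound : ∀ k, P ((fun ω => inner ℝ (b k) (G ω)) ⁻¹' {x | |x + a k| ≤ R}) ≤
      ENNReal.ofReal (2 * R * M * if k = i then w else 1) := by
    intro k
    rw [mul_assoc]
    refine measure_abs_add_le_of_pdf_le (by fun_prop) (hv0 k) (hlaw k)
      (by split_ifs <;> positivity) fun x hx => (hpdf k x).trans ?_
    rw [← hMdef]
    split_ifs with hk
    · subst hk
      have h3 : (1 + ‖y‖) / (2 * d) ≤ 1 + |x| := by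
        rw [div_le_iff₀ (by positivity)]
        have h4 : |a k| ≤ |x + a k| + |x| := by
          have := abs_sub (x + a k) x
          simpa using this
        have : (1 + |a k|) / 2 ≤ 1 + |x| := by linarith [abs_nonneg x, abs_nonneg (a k)]
        nlinarith
      rw [div_eq_mul_inv]
      gcongr
      rw [hw, ← div_pow, ← inv_pow]
      gcongr
      rw [inv_le_comm₀ (by positivity) (by positivity), inv_div]
      exact h3
    · rw [mul_one]
      exact div_le_self hM.le (one_le_pow₀ (by linarith [abs_nonneg x]))
  have hmeas : ∀ k, MeasurableSet {x : ℝ | |x + a k| ≤ R} := fun k =>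
    measurableSet_le (by fun_prop) measurable_const
  refine (measure_mono hsub).trans ?_
  rw [hind.measure_inter_preimage_eq_mul Finset.univ fun k _ => hmeas k]
  refine (Finset.prod_le_prod' fun k _ => hbound k).trans ?_
  rw [← ENNReal.ofReal_prod_of_nonneg fun k _ => by split_ifs <;> positivity]
  refine ENNReal.ofReal_le_ofReal ?_
  rw [Finset.prod_mul_distrib, Finset.prod_ite_eq' Finset.univ i (fun _ => w)]
  simp only [Finset.prod_const, Finset.card_univ, Fintype.card_fin, Finset.mem_univ, if_true]
  rw [hw, ← div_pow, ← mul_pow]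
  have : 2 * R * M * (2 * d / (1 + ‖y‖)) = 8 * d * M * η := by
    rw [hR]; field_simp; ring
  rw [this]
  gcongr
  linarith

theorem lintegral_enorm_pow_gaussianReal_lt_top (p : ℕ) :
    ∫⁻ x, ‖x‖ₑ ^ p ∂(gaussianReal 0 1) < ⊤ := by
  rcases Nat.eq_zero_or_pos p with rfl | hp
  · simp
  have h := (memLp_id_gaussianReal (μ := 0) (v := 1) p).eLpNorm_lt_top
  have h2 := lintegral_rpow_enorm_lt_top_of_eLpNorm_lt_top (by exact_mod_cast hp.ne') (by simp) h
  simpa using h2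

/-- All moments of a centred Gaussian vector are controlled by the second one. -/
theorem exists_lintegral_enorm_pow_le_of_hasGaussianLaw {Ω : Type*} [MeasurableSpace Ω]
    (P : Measure Ω) [IsProbabilityMeasure P] (d p : ℕ) :
    ∃ C : ℝ, 0 ≤ C ∧ ∀ (V : Ω → EuclideanSpace ℝ (Fin d)) (σ : ℝ), HasGaussianLaw V P →
      ∫ ω, V ω ∂P = 0 → 0 ≤ σ → ∫ ω, ‖V ω‖ ^ 2 ∂P ≤ σ ^ 2 →
      ∫⁻ ω, ‖V ω‖ₑ ^ p ∂P ≤ ENNReal.ofReal (C * σ ^ p) := by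
  rcases Nat.eq_zero_or_pos p with rfl | hp
  · exact ⟨1, by simp⟩
  set m := ∫⁻ x, ‖x‖ₑ ^ p ∂(gaussianReal 0 1) with hm
  have hmtop : m ≠ ⊤ := (lintegral_enorm_pow_gaussianReal_lt_top p).ne
  refine ⟨(d : ℝ) ^ p * m.toReal, by positivity, fun V σ hV hV0 hσ hV2 => ?_⟩
  have hcoord : ∀ i, ∫⁻ ω, ‖V ω i‖ₑ ^ p ∂P ≤ ENNReal.ofReal (σ ^ p) * m := by
    intro i
    have hVi : HasGaussianLaw (fun ω => V ω i) P := hV.map_fun (EuclideanSpace.proj i)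
    have hmean : ∫ ω, V ω i ∂P = 0 := by
      have := (EuclideanSpace.proj (𝕜 := ℝ) i).integral_comp_comm hV.integrable
      simpa [hV0] using this
    set w := Var[fun ω => V ω i; P].toNNReal with hw
    have hwle : (w : ℝ) ≤ σ ^ 2 := by
      rw [hw, Real.coe_toNNReal _ (variance_nonneg _ _),
        variance_of_integral_eq_zero hVi.aemeasurable hmean]
      refine le_trans (integral_mono hVi.memLp_two.integrable_sq ?_ fun ω => ?_) hV2
      · exact hV.memLp_two.integrable_norm_pow (by norm_num)
      · rw [← sq_abs, ← Real.norm_eq_abs]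
        exact pow_le_pow_left₀ (norm_nonneg _) (PiLp.norm_apply_le (V ω) i) 2
    have hlaw : P.map (fun ω => V ω i) = (gaussianReal 0 1).map (√(w : ℝ) * ·) := by
      rw [hVi.map_eq_gaussianReal, hmean, gaussianReal_map_const_mul]
      congr 1
      · simp
      · ext; simp [hw, variance_nonneg]
    calc ∫⁻ ω, ‖V ω i‖ₑ ^ p ∂P = ∫⁻ x, ‖x‖ₑ ^ p ∂(P.map (fun ω => V ω i)) := by
          rw [lintegral_map' (by fun_prop) hVi.aemeasurable]
      _ = ∫⁻ x, ‖√(w : ℝ)‖ₑ ^ p * ‖x‖ₑ ^ p ∂(gaussianReal 0 1) := by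
          rw [hlaw, lintegral_map (by fun_prop) (by fun_prop)]
          simp only [enorm_mul, mul_pow]
      _ = ‖√(w : ℝ)‖ₑ ^ p * m := by rw [lintegral_const_mul _ (by fun_prop)]
      _ ≤ _ := by
          gcongr
          rw [ENNReal.ofReal_pow hσ, Real.enorm_of_nonneg (Real.sqrt_nonneg _)]
          gcongr
          exact Real.sqrt_le_iff.2 ⟨hσ, hwle⟩
  have hpt : ∀ ω, ‖V ω‖ₑ ^ p ≤ (d : ENNReal) ^ (p - 1) * ∑ i, ‖V ω i‖ₑ ^ p := by
    intro ω
    have h1 : ‖V ω‖ₑ ≤ ∑ i, ‖V ω i‖ₑ := by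
      conv_lhs => rw [← (EuclideanSpace.basisFun (Fin d) ℝ).sum_repr (V ω)]
      refine (enorm_sum_le _ _).trans (Finset.sum_le_sum fun i _ => ?_)
      rw [enorm_smul]
      simp [enorm_eq_nnnorm]
    have h2 := ENNReal.rpow_sum_le_const_mul_sum_rpow Finset.univ (fun i => ‖V ω i‖ₑ)
      (p := p) (by exact_mod_cast hp)
    have h3 : ((p : ℝ) - 1) = ((p - 1 : ℕ) : ℝ) := by
      rw [Nat.cast_sub hp, Nat.cast_one]
    rw [h3] at h2
    simp only [ENNReal.rpow_natCast, Finset.card_univ, Fintype.card_fin] at h2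
    exact (pow_le_pow_left' h1 p).trans h2
  calc ∫⁻ ω, ‖V ω‖ₑ ^ p ∂P ≤ ∫⁻ ω, (d : ENNReal) ^ (p - 1) * ∑ i, ‖V ω i‖ₑ ^ p ∂P :=
        lintegral_mono hpt
    _ = (d : ENNReal) ^ (p - 1) * ∑ i, ∫⁻ ω, ‖V ω i‖ₑ ^ p ∂P := by
        have hm : ∀ i, AEMeasurable (fun ω => ‖V ω i‖ₑ ^ p) P := fun i => by
          have hVi : HasGaussianLaw (fun ω => V ω i) P := hV.map_fun (EuclideanSpace.proj i)
          exact hVi.aemeasurable.enorm.pow_const p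
        rw [lintegral_const_mul'' _ (Finset.aemeasurable_fun_sum _ fun i _ => hm i),
          lintegral_finsetSum' _ fun i _ => hm i]
    _ ≤ (d : ENNReal) ^ (p - 1) * ∑ _i : Fin d, ENNReal.ofReal (σ ^ p) * m := by
        gcongr with i; exact hcoord i
    _ = (d : ENNReal) ^ p * (ENNReal.ofReal (σ ^ p) * m) := by
        rw [Finset.sum_const, Finset.card_univ, Fintype.card_fin, nsmul_eq_mul, ← mul_assoc,
          ← pow_succ, Nat.sub_add_cancel hp]
    _ = _ := by
        rw [ENNReal.ofReal_mul (by positivity), ENNReal.ofReal_mul (by positivity),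
          ENNReal.ofReal_toReal hmtop, ENNReal.ofReal_pow (Nat.cast_nonneg d),
          ENNReal.ofReal_natCast]
        ring

/-! ### The anisotropic metric, covering numbers and chaining -/

/-- The anisotropic box of radius `r` around `t`: all `s` with `|s_j - t_j| ≤ r ^ (1 / H_j)` for
every `j`. -/
def anisoBox {N : ℕ} (H : Fin N → ℝ) (t : EuclideanSpace ℝ (Fin N)) (r : ℝ) :
    Set (EuclideanSpace ℝ (Fin N)) :=
  {s | ∀ j, |s j - t j| ≤ r ^ (1 / H j)}

section AnisotropicMetric

variable {N : ℕ} {H : Fin N → ℝ}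

theorem anisoDist_nonneg (s t : EuclideanSpace ℝ (Fin N)) : 0 ≤ anisoDist H s t :=
  Finset.sum_nonneg fun _ _ => Real.rpow_nonneg (abs_nonneg _) _

theorem anisoDist_comm (s t : EuclideanSpace ℝ (Fin N)) : anisoDist H s t = anisoDist H t s := by
  simp only [anisoDist, abs_sub_comm]

theorem anisoDist_triangle (hH : ∀ j, 0 < H j ∧ H j ≤ 1) (s t u : EuclideanSpace ℝ (Fin N)) :
    anisoDist H s u ≤ anisoDist H s t + anisoDist H t u := by
  simp only [anisoDist]
  rw [← Finset.sum_add_distrib]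
  refine Finset.sum_le_sum fun j _ => ?_
  calc |s j - u j| ^ H j ≤ (|s j - t j| + |t j - u j|) ^ H j :=
        Real.rpow_le_rpow (abs_nonneg _) (abs_sub_le _ _ _) (hH j).1.le
    _ ≤ _ := Real.rpow_add_le_add_rpow (abs_nonneg _) (abs_nonneg _) (hH j).1.le (hH j).2

theorem continuous_anisoDist (hH : ∀ j, 0 < H j ∧ H j ≤ 1) (t : EuclideanSpace ℝ (Fin N)) :
    Continuous fun s => anisoDist H s t := by
  refine continuous_finsetSum _ fun j _ => Continuous.rpow_const (by fun_prop) fun _ =>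
    Or.inr (hH j).1.le

theorem anisoDist_self (hH : ∀ j, 0 < H j ∧ H j ≤ 1) (t : EuclideanSpace ℝ (Fin N)) :
    anisoDist H t t = 0 := by
  simp [anisoDist, fun j => Real.zero_rpow (hH j).1.ne']

theorem anisoQ_nonneg (hH : ∀ j, 0 < H j ∧ H j ≤ 1) : 0 ≤ anisoQ H :=
  Finset.sum_nonneg fun j _ => one_div_nonneg.2 (hH j).1.le

theorem anisoDist_le_of_mem_anisoBox (hH : ∀ j, 0 < H j ∧ H j ≤ 1)
    {s t : EuclideanSpace ℝ (Fin N)} {r : ℝ} (hr : 0 ≤ r) (h : s ∈ anisoBox H t r) :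
    anisoDist H s t ≤ N * r := by
  calc anisoDist H s t ≤ ∑ _j : Fin N, r := by
        refine Finset.sum_le_sum fun j _ => ?_
        calc |s j - t j| ^ H j ≤ (r ^ (1 / H j)) ^ H j :=
              Real.rpow_le_rpow (abs_nonneg _) (h j) (hH j).1.le
          _ = r := by
              rw [← Real.rpow_mul hr, one_div_mul_cancel (hH j).1.ne', Real.rpow_one]
    _ = N * r := by simp

/-- An anisotropic box of radius `a` is covered by at most `5 ^ N * (a / ε) ^ Q` boxes of
radius `ε`, with centres in the set that is to be covered. -/
theorem exists_finset_card_le_cover_anisoBox (hH : ∀ j, 0 < H j ∧ H j ≤ 1)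
    {I : Set (EuclideanSpace ℝ (Fin N))} (x₀ : EuclideanSpace ℝ (Fin N)) {a ε : ℝ}
    (hε : 0 < ε) (hεa : ε ≤ a) (T : Set I) (hT : ∀ s ∈ T, (s : EuclideanSpace ℝ (Fin N)) ∈
      anisoBox H x₀ a) :
    ∃ C : Finset I, (∀ t ∈ C, t ∈ T) ∧ (C.card : ℝ) ≤ 5 ^ N * (a / ε) ^ anisoQ H ∧
      ∀ s ∈ T, ∃ t ∈ C, (s : EuclideanSpace ℝ (Fin N)) ∈ anisoBox H t ε := by
  classical
  rcases T.eq_empty_or_nonempty with rfl | ⟨s₀, hs₀⟩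
  · refine ⟨∅, by simp, ?_, by simp⟩
    have : 0 < a := hε.trans_le hεa
    simp only [Finset.card_empty, Nat.cast_zero]
    positivity
  have : Nonempty I := ⟨s₀⟩
  have ha : 0 < a := hε.trans_le hεa
  set q : I → Fin N → ℤ := fun s j => ⌊(s.1 j - x₀ j) / ε ^ (1 / H j)⌋ with hq
  set m : Fin N → ℤ := fun j => ⌈(a / ε) ^ (1 / H j)⌉ with hm
  have hεj : ∀ j, 0 < ε ^ (1 / H j) := fun j => Real.rpow_pos_of_pos hε _
  have hqm : ∀ s ∈ T, q s ∈ Fintype.piFinset fun j => Finset.Icc (-m j) (m j) := by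
    intro s hs
    rw [Fintype.mem_piFinset]
    intro j
    have h1 := hT s hs j
    have h2 : |(s.1 j - x₀ j) / ε ^ (1 / H j)| ≤ (a / ε) ^ (1 / H j) := by
      rw [abs_div, abs_of_pos (hεj j), Real.div_rpow ha.le hε.le]
      gcongr
    rw [abs_le] at h2
    rw [Finset.mem_Icc]
    constructor
    · rw [hm, hq, ← Int.floor_neg]
      exact Int.floor_le_floor h2.1
    · have h3 := (Int.floor_le _).trans (h2.2.trans (Int.le_ceil _))
      exact Int.cast_le.1 h3
  refine ⟨((Fintype.piFinset fun j => Finset.Icc (-m j) (m j)).filter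
    fun k => ∃ s ∈ T, q s = k).image (Function.invFunOn q T), ?_, ?_, ?_⟩
  · intro t ht
    simp only [Finset.mem_image, Finset.mem_filter] at ht
    obtain ⟨k, ⟨-, hk⟩, rfl⟩ := ht
    exact Function.invFunOn_mem hk
  · have hcard := (Finset.card_image_le (s := (Fintype.piFinset fun j =>
      Finset.Icc (-m j) (m j)).filter fun k => ∃ s ∈ T, q s = k)
      (f := Function.invFunOn q T)).trans (Finset.card_filter_le _ _)
    rw [Fintype.card_piFinset] at hcard
    calc _ ≤ ((∏ j, (Finset.Icc (-m j) (m j)).card : ℕ) : ℝ) := by exact_mod_cast hcard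
      _ = ∏ j, ((Finset.Icc (-m j) (m j)).card : ℝ) := by push_cast; rfl
      _ ≤ ∏ j, 5 * (a / ε) ^ (1 / H j) := by
          refine Finset.prod_le_prod (fun _ _ => Nat.cast_nonneg _) fun j _ => ?_
          have h1 : (1 : ℝ) ≤ (a / ε) ^ (1 / H j) :=
            Real.one_le_rpow ((one_le_div hε).2 hεa) (one_div_nonneg.2 (hH j).1.le)
          have h2 : (m j : ℝ) < (a / ε) ^ (1 / H j) + 1 := Int.ceil_lt_add_one _
          have h3 : 0 ≤ m j := Int.ceil_nonneg (by linarith)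
          rw [Int.card_Icc]
          have h4 : ((m j + 1 - -m j).toNat : ℝ) = 2 * m j + 1 := by
            have : (((m j + 1 - -m j).toNat : ℤ) : ℝ) = ((m j + 1 - -m j : ℤ) : ℝ) := by
              rw [Int.toNat_of_nonneg (by omega)]
            push_cast at this
            rw [this]; ring
          rw [h4]
          linarith
      _ = _ := by
          rw [Finset.prod_mul_distrib, ← Real.rpow_sum_of_pos (by positivity)]
          simp [anisoQ]
  · intro s hs
    refine ⟨Function.invFunOn q T (q s), ?_, fun j => ?_⟩
    · exact Finset.mem_image_of_mem _ (Finset.mem_filter.2 ⟨hqm s hs, s, hs, rfl⟩)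
    · have h1 : q (Function.invFunOn q T (q s)) = q s := Function.invFunOn_eq ⟨s, hs, rfl⟩
      have h2 := Int.abs_sub_lt_one_of_floor_eq_floor (congrFun h1 j).symm
      rw [← sub_div, abs_div, abs_of_pos (hεj j), div_lt_one (hεj j)] at h2
      simpa using h2.le

theorem tendsto_of_mem_anisoBox (hH : ∀ j, 0 < H j ∧ H j ≤ 1)
    {I : Set (EuclideanSpace ℝ (Fin N))} {u : ℕ → I} {s : I} {ε : ℕ → ℝ}
    (hε : Filter.Tendsto ε Filter.atTop (nhds 0)) (h : ∀ n, s.1 ∈ anisoBox H (u n) (ε n)) :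
    Filter.Tendsto u Filter.atTop (nhds s) := by
  rw [tendsto_subtype_rng, (PiLp.homeomorph 2 (fun _ : Fin N => ℝ)).isInducing.tendsto_nhds_iff,
    tendsto_pi_nhds]
  intro j
  have h1 : Filter.Tendsto (fun n => ε n ^ (1 / H j)) Filter.atTop (nhds 0) := by
    have := hε.rpow_const (p := 1 / H j) (Or.inr (one_div_nonneg.2 (hH j).1.le))
    rwa [Real.zero_rpow (one_div_ne_zero (hH j).1.ne')] at this
  rw [tendsto_iff_dist_tendsto_zero]
  refine squeeze_zero (fun _ => dist_nonneg) (fun n => ?_) h1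
  rw [dist_comm, Real.dist_eq]
  exact h n j

/-- Nets of the box of radius `r` around `t₀` at the scales `r * 4 ^ (-n)`. The first net consists
of the centre only. -/
theorem exists_nets_anisoBox (hH : ∀ j, 0 < H j ∧ H j ≤ 1)
    {I : Set (EuclideanSpace ℝ (Fin N))} (t₀ : I) {r : ℝ} (hr : 0 < r) (n : ℕ) :
    ∃ C : Finset I, (n = 0 → C = {t₀}) ∧
      (C.card : ℝ) ≤ 5 ^ N * ((4 : ℝ) ^ n) ^ anisoQ H ∧
      ∀ s : I, s.1 ∈ anisoBox H t₀ r → ∃ t ∈ C, s.1 ∈ anisoBox H t (r * (4⁻¹) ^ n) := by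
  rcases Nat.eq_zero_or_pos n with rfl | hn
  · refine ⟨{t₀}, by simp, ?_, by simp⟩
    simp only [Finset.card_singleton, Nat.cast_one, pow_zero, Real.one_rpow, mul_one]
    exact one_le_pow₀ (by norm_num)
  · obtain ⟨C, -, h2, h3⟩ := exists_finset_card_le_cover_anisoBox hH t₀.1 (a := r)
      (ε := r * 4⁻¹ ^ n) (by positivity)
      (mul_le_of_le_one_right hr.le (pow_le_one₀ (by norm_num) (by norm_num)))
      {s : I | s.1 ∈ anisoBox H t₀ r} fun s hs => hs
    refine ⟨C, fun h => by omega, ?_, h3⟩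
    convert h2 using 3
    rw [inv_pow]
    field_simp

end AnisotropicMetric

theorem enorm_sub_pow_le_of_geometric_steps {E : Type*} [NormedAddCommGroup E] {p : ℕ}
    (hp : p ≠ 0) {x : ℕ → E} {a : E} (hlim : Filter.Tendsto x Filter.atTop (nhds a))
    {B : ENNReal} (h : ∀ n, 2 ^ (n * p) * ‖x n - x (n + 1)‖ₑ ^ p ≤ B) :
    ‖a - x 0‖ₑ ^ p ≤ 2 ^ p * B := by
  have hp' : (0 : ℝ) < p := by exact_mod_cast Nat.pos_of_ne_zero hp
  have hstep : ∀ n, edist (x n) (x (n + 1)) ≤ (2⁻¹ : ENNReal) ^ n * B ^ (1 / p : ℝ) := by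
    intro n
    have h1 := h n
    rw [pow_mul, ← mul_pow, ← edist_eq_enorm_sub] at h1
    have h2 : 2 ^ n * edist (x n) (x (n + 1)) ≤ B ^ (1 / p : ℝ) := by
      rw [one_div, ENNReal.le_rpow_inv_iff hp', ENNReal.rpow_natCast]
      exact h1
    calc _ = (2⁻¹ : ENNReal) ^ n * (2 ^ n * edist (x n) (x (n + 1))) := by
          rw [← mul_assoc, ← mul_pow, ENNReal.inv_mul_cancel (by norm_num) (by norm_num),
            one_pow, one_mul]
      _ ≤ _ := by gcongr
  have h3 := edist_le_tsum_of_edist_le_of_tendsto₀ _ hstep hlim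
  rw [ENNReal.tsum_mul_right, ENNReal.tsum_geometric, ENNReal.one_sub_inv_two, inv_inv,
    edist_comm, edist_eq_enorm_sub] at h3
  calc ‖a - x 0‖ₑ ^ p ≤ (2 * B ^ (1 / p : ℝ)) ^ p := pow_le_pow_left' h3 p
    _ = 2 ^ p * B := by
        rw [mul_pow, ← ENNReal.rpow_natCast (B ^ (1 / p : ℝ)), ← ENNReal.rpow_mul,
          one_div_mul_cancel hp'.ne', ENNReal.rpow_one]

/-- The chaining functional `∑ n, 2 ^ (n p) ∑ (u,v) ∈ D n, ‖z u - z v‖ ^ p` of a path `z`, for a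
sequence `D` of finite sets of pairs of indices. -/
noncomputable def chainingFunctional {ι E : Type*} [NormedAddCommGroup E] (p : ℕ)
    (D : ℕ → Finset (ι × ι)) (z : ι → E) : ENNReal :=
  ∑' n, 2 ^ (n * p) * ∑ uv ∈ D n, ‖z uv.1 - z uv.2‖ₑ ^ p

theorem measurable_chainingFunctional {ι : Type*} {d : ℕ} (p : ℕ) (D : ℕ → Finset (ι × ι)) :
    Measurable (chainingFunctional (E := EuclideanSpace ℝ (Fin d)) p D) := by
  refine Measurable.tsum fun n => Measurable.const_mul ?_ _
  exact Finset.measurable_sum _ fun uv _ => by fun_prop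

theorem two_pow_mul_enorm_sub_pow_le_chainingFunctional {ι E : Type*} [NormedAddCommGroup E]
    (p : ℕ) (D : ℕ → Finset (ι × ι)) (z : ι → E) (n : ℕ) {u v : ι} (h : (u, v) ∈ D n) :
    2 ^ (n * p) * ‖z u - z v‖ₑ ^ p ≤ chainingFunctional p D z := by
  have h1 : ‖z u - z v‖ₑ ^ p ≤ ∑ uv ∈ D n, ‖z uv.1 - z uv.2‖ₑ ^ p :=
    Finset.single_le_sum_of_canonicallyOrdered
      (f := fun uv : ι × ι => ‖z uv.1 - z uv.2‖ₑ ^ p) h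
  calc _ ≤ 2 ^ (n * p) * ∑ uv ∈ D n, ‖z uv.1 - z uv.2‖ₑ ^ p := by gcongr
    _ ≤ _ := ENNReal.le_tsum (f := fun n => 2 ^ (n * p) * ∑ uv ∈ D n, ‖z uv.1 - z uv.2‖ₑ ^ p) n

/-- If the number of pairs grows like `16 ^ (n Q)` and the pairs of level `n` have distance of
order `4 ^ (-n)`, then the series of the means converges for `p ≥ 4 Q + 1`. -/
theorem lintegral_chainingFunctional_le {ι : Type*} {d : ℕ} {Ω : Type*} [MeasurableSpace Ω]
    (P : Measure Ω) {p : ℕ} {Q : ℝ} (hp : 4 * Q + 1 ≤ p) (D : ℕ → Finset (ι × ι)) {c a : ℝ}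
    (hc : 0 ≤ c) (ha : 0 ≤ a) (hcard : ∀ n, ((D n).card : ℝ) ≤ c * (16 ^ Q) ^ n)
    (Z : ι → Ω → EuclideanSpace ℝ (Fin d)) (hZ : ∀ s, Measurable (Z s))
    (hmom : ∀ n, ∀ uv ∈ D n, ∫⁻ ω, ‖Z uv.1 ω - Z uv.2 ω‖ₑ ^ p ∂P ≤
      ENNReal.ofReal ((a * 4⁻¹ ^ n) ^ p)) :
    ∫⁻ ω, chainingFunctional p D (fun t => Z t ω) ∂P ≤ ENNReal.ofReal (2 * c * a ^ p) := by
  have hA0 : 0 ≤ c * a ^ p := by positivity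
  have h16 : (2 : ℝ) ^ p * 4⁻¹ ^ p * 16 ^ Q ≤ 2⁻¹ := by
    have h2 : (16 : ℝ) ^ Q = 2 ^ (4 * Q) := by
      rw [Real.rpow_mul (by norm_num)]; norm_num
    have h3 : (2 : ℝ) ^ (4 * Q) ≤ 2 ^ ((p : ℝ) - 1) :=
      Real.rpow_le_rpow_of_exponent_le (by norm_num) (by linarith)
    rw [Real.rpow_sub (by norm_num), Real.rpow_natCast, Real.rpow_one] at h3
    rw [h2]
    calc _ ≤ (2 : ℝ) ^ p * 4⁻¹ ^ p * (2 ^ p / 2) := by gcongr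
      _ = (2 * 4⁻¹ * 2) ^ p / 2 := by rw [mul_pow, mul_pow]; ring
      _ = 2⁻¹ := by norm_num
  have hterm : ∀ n, ∫⁻ ω, 2 ^ (n * p) * ∑ uv ∈ D n, ‖Z uv.1 ω - Z uv.2 ω‖ₑ ^ p ∂P ≤
      ENNReal.ofReal (c * a ^ p) * (2⁻¹ : ENNReal) ^ n := by
    intro n
    rw [lintegral_const_mul _ (by fun_prop), lintegral_finsetSum _ (by fun_prop)]
    calc _ ≤ 2 ^ (n * p) * ∑ uv ∈ D n, ENNReal.ofReal ((a * 4⁻¹ ^ n) ^ p) := by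
          gcongr with uv huv
          exact hmom n uv huv
      _ = ENNReal.ofReal (2 ^ (n * p) * ((D n).card * (a * 4⁻¹ ^ n) ^ p)) := by
          rw [Finset.sum_const, nsmul_eq_mul, ENNReal.ofReal_mul (by positivity),
            ENNReal.ofReal_mul (by positivity), ENNReal.ofReal_natCast,
            ENNReal.ofReal_pow (zero_le_two : (0 : ℝ) ≤ 2), ENNReal.ofReal_ofNat]
      _ ≤ ENNReal.ofReal (c * a ^ p * 2⁻¹ ^ n) := by
          refine ENNReal.ofReal_le_ofReal ?_
          calc _ ≤ 2 ^ (n * p) * (c * (16 ^ Q) ^ n * (a * 4⁻¹ ^ n) ^ p) := by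
                gcongr
                exact hcard n
            _ = c * a ^ p * (2 ^ p * 4⁻¹ ^ p * 16 ^ Q) ^ n := by
                simp only [mul_pow, ← pow_mul]
                ring
            _ ≤ _ := by gcongr
      _ = _ := by
          rw [ENNReal.ofReal_mul hA0, ENNReal.ofReal_pow (by norm_num),
            ENNReal.ofReal_inv_of_pos (by norm_num), ENNReal.ofReal_ofNat]
  calc ∫⁻ ω, chainingFunctional p D (fun t => Z t ω) ∂P
      = ∑' n, ∫⁻ ω, 2 ^ (n * p) * ∑ uv ∈ D n, ‖Z uv.1 ω - Z uv.2 ω‖ₑ ^ p ∂P :=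
        lintegral_tsum fun n => by fun_prop
    _ ≤ ∑' n, ENNReal.ofReal (c * a ^ p) * (2⁻¹ : ENNReal) ^ n := ENNReal.tsum_le_tsum hterm
    _ = ENNReal.ofReal (c * a ^ p) * 2 := by
        rw [ENNReal.tsum_mul_left, ENNReal.tsum_geometric, ENNReal.one_sub_inv_two, inv_inv]
    _ = _ := by
        rw [← ENNReal.ofReal_ofNat 2, ← ENNReal.ofReal_mul hA0]
        congr 1
        ring

/-- Chaining with `p`-th moments. The increments of a path `z` over the box of radius `r` around
`t₀` are controlled by a functional `Φ z` that involves countably many values of `z` only, and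
whose mean is of order `r ^ p` as soon as the increments have `p`-th moments of order `ρ ^ p`. -/
theorem exists_chaining_functional {N d : ℕ} {H : Fin N → ℝ} (hH : ∀ j, 0 < H j ∧ H j ≤ 1)
    {Ω : Type*} [MeasurableSpace Ω] (P : Measure Ω)
    {I : Set (EuclideanSpace ℝ (Fin N))} {p : ℕ} (hp : 4 * anisoQ H + 1 ≤ p) (t₀ : I)
    {r : ℝ} (hr : 0 < r) :
    ∃ Φ : (I → EuclideanSpace ℝ (Fin d)) → ENNReal, Measurable Φ ∧
      (∀ z, Continuous z → ∀ s : I, s.1 ∈ anisoBox H t₀ r →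
        ‖z s - z t₀‖ₑ ^ p ≤ 2 ^ p * Φ z) ∧
      ∀ (Z : I → Ω → EuclideanSpace ℝ (Fin d)) (K : ℝ), 0 ≤ K → (∀ s, Measurable (Z s)) →
        (∀ s t : I, ∫⁻ ω, ‖Z s ω - Z t ω‖ₑ ^ p ∂P ≤
          ENNReal.ofReal ((K * anisoDist H s t) ^ p)) →
        ∫⁻ ω, Φ (fun t => Z t ω) ∂P ≤
          ENNReal.ofReal (2 * (25 ^ N * 4 ^ anisoQ H * (2 * N) ^ p) * (K * r) ^ p) := by
  classical
  have hQ := anisoQ_nonneg hH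
  have hp1 : (1 : ℝ) ≤ p := by linarith
  have hp0 : p ≠ 0 := by rintro rfl; norm_num at hp1
  choose T hT0 hTcard hTcov using exists_nets_anisoBox hH t₀ hr
  set pairs : ℕ → Finset (I × I) := fun n =>
    (T n ×ˢ T (n + 1)).filter fun uv => anisoDist H uv.1 uv.2 ≤ 2 * N * (r * 4⁻¹ ^ n) with hpairs
  refine ⟨chainingFunctional p pairs, measurable_chainingFunctional p pairs, ?_, ?_⟩
  · intro z hz s hs
    choose π hπT hπs using fun n => hTcov n s hs
    have hε : Filter.Tendsto (fun n : ℕ => r * (4⁻¹ : ℝ) ^ n) Filter.atTop (nhds 0) := by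
      simpa using (tendsto_pow_atTop_nhds_zero_of_lt_one (r := (4⁻¹ : ℝ)) (by norm_num)
        (by norm_num)).const_mul r
    have hlim := tendsto_of_mem_anisoBox hH hε hπs
    have hπ0 : π 0 = t₀ := by
      have := hπT 0
      rwa [hT0 0 rfl, Finset.mem_singleton] at this
    have hmem : ∀ n, (π n, π (n + 1)) ∈ pairs n := by
      intro n
      rw [hpairs, Finset.mem_filter, Finset.mem_product]
      refine ⟨⟨hπT n, hπT (n + 1)⟩, (anisoDist_triangle hH _ s.1 _).trans ?_⟩
      have h1 := anisoDist_le_of_mem_anisoBox hH (by positivity) (hπs n)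
      have h2 := anisoDist_le_of_mem_anisoBox hH (by positivity) (hπs (n + 1))
      rw [anisoDist_comm] at h1
      have h3 : N * (r * (4⁻¹ : ℝ) ^ (n + 1)) ≤ N * (r * 4⁻¹ ^ n) := by
        gcongr _ * (_ * ?_)
        exact pow_le_pow_of_le_one (by norm_num) (by norm_num) (Nat.le_succ n)
      linarith
    rw [← hπ0]
    exact enorm_sub_pow_le_of_geometric_steps hp0 ((hz.tendsto s).comp hlim) fun n =>
      two_pow_mul_enorm_sub_pow_le_chainingFunctional p pairs z n (hmem n)
  · intro Z K hK hZ hmom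
    have hcard : ∀ n, ((pairs n).card : ℝ) ≤ 25 ^ N * 4 ^ anisoQ H * (16 ^ anisoQ H) ^ n := by
      intro n
      have h1 : (pairs n).card ≤ (T n).card * (T (n + 1)).card := by
        rw [← Finset.card_product]; exact Finset.card_filter_le _ _
      calc ((pairs n).card : ℝ) ≤ (T n).card * (T (n + 1)).card := by exact_mod_cast h1
        _ ≤ (5 ^ N * ((4 : ℝ) ^ n) ^ anisoQ H) * (5 ^ N * ((4 : ℝ) ^ (n + 1)) ^ anisoQ H) := by
            gcongr
            · exact hTcard n
            · exact hTcard (n + 1)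
        _ = 25 ^ N * 4 ^ anisoQ H * (16 ^ anisoQ H) ^ n := by
            rw [pow_succ, Real.mul_rpow (by positivity) (by positivity),
              show (25 : ℝ) = 5 * 5 by norm_num, show (16 : ℝ) = 4 * 4 by norm_num,
              Real.mul_rpow (by positivity) (by positivity), mul_pow, mul_pow,
              ← Real.rpow_natCast 4 n, ← Real.rpow_mul (by norm_num), mul_comm (n : ℝ),
              Real.rpow_mul (by norm_num), Real.rpow_natCast]
            ring
    refine (lintegral_chainingFunctional_le P hp pairs (a := 2 * N * (K * r)) (by positivity)
      (by positivity) hcard Z hZ fun n uv huv => (hmom _ _).trans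
        (ENNReal.ofReal_le_ofReal ?_)).trans (le_of_eq ?_)
    · have h1 := (Finset.mem_filter.1 huv).2
      have h2 := anisoDist_nonneg (H := H) uv.1.1 uv.2.1
      calc _ ≤ (K * (2 * N * (r * 4⁻¹ ^ n))) ^ p := by gcongr
        _ = _ := by ring
    · congr 1; ring

/-! ### Regression on the value of the field at one point -/

section Regression

variable {N d : ℕ} {Ω : Type*} [MeasurableSpace Ω] {P : Measure Ω}

theorem integrable_inner_smul {G V : Ω → EuclideanSpace ℝ (Fin d)} (hG : MemLp G 2 P)
    (hV : MemLp V 2 P) (u : EuclideanSpace ℝ (Fin d)) :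
    Integrable (fun ω => inner ℝ u (G ω) • V ω) P := by
  have h : MemLp (fun ω => inner ℝ u (G ω)) 2 P := hG.const_inner u
  have := hV.smul (p := 2) (q := 2) (r := 1) h
  exact memLp_one_iff_integrable.1 this

theorem integrable_inner_mul_inner {G V : Ω → EuclideanSpace ℝ (Fin d)} (hG : MemLp G 2 P)
    (hV : MemLp V 2 P) (u v : EuclideanSpace ℝ (Fin d)) :
    Integrable (fun ω => inner ℝ u (G ω) * inner ℝ v (V ω)) P :=
  MemLp.integrable_mul (hG.const_inner u) (hV.const_inner v)

/-- The spectral theorem for the covariance operator: the coordinates of a square integrable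
random vector in a suitable orthonormal basis are orthogonal in `L²`. -/
theorem exists_orthonormalBasis_integral_inner_mul_inner_eq_zero
    {G : Ω → EuclideanSpace ℝ (Fin d)} (hG : MemLp G 2 P) :
    ∃ b : OrthonormalBasis (Fin d) ℝ (EuclideanSpace ℝ (Fin d)), ∀ i j, i ≠ j →
      ∫ ω, inner ℝ (b i) (G ω) * inner ℝ (b j) (G ω) ∂P = 0 := by
  let T : EuclideanSpace ℝ (Fin d) →ₗ[ℝ] EuclideanSpace ℝ (Fin d) :=
    { toFun := fun v => ∫ ω, inner ℝ v (G ω) • G ω ∂P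
      map_add' := fun u v => by
        rw [← integral_add (integrable_inner_smul hG hG u) (integrable_inner_smul hG hG v)]
        simp only [inner_add_left, add_smul]
      map_smul' := fun a v => by
        simp only [inner_smul_left, RingHom.id_apply, conj_trivial, mul_smul]
        rw [integral_smul] }
  have hT : ∀ u v, inner ℝ (T u) v = ∫ ω, inner ℝ u (G ω) * inner ℝ v (G ω) ∂P := by
    intro u v
    rw [real_inner_comm]
    change inner ℝ v (∫ ω, inner ℝ u (G ω) • G ω ∂P) = _
    rw [← integral_inner (integrable_inner_smul hG hG u)]
    simp only [inner_smul_right]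
  have hsymm : T.IsSymmetric := fun u v => by
    rw [hT, real_inner_comm, hT]
    simp only [mul_comm]
  have hn : Module.finrank ℝ (EuclideanSpace ℝ (Fin d)) = d := finrank_euclideanSpace_fin
  refine ⟨hsymm.eigenvectorBasis hn, fun i j hij => ?_⟩
  rw [← hT, hsymm.apply_eigenvectorBasis, inner_smul_left,
    (hsymm.eigenvectorBasis hn).inner_eq_zero hij, mul_zero]

variable {I : Set (EuclideanSpace ℝ (Fin N))}

/-- The coefficient of `⟪b i, X t₀⟫` in the linear regression of `X s` on `X t₀`, for an
orthonormal basis `b` in which the coordinates of `X t₀` are uncorrelated. -/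
noncomputable def regressionCoeff (P : Measure Ω) (X : I → Ω → EuclideanSpace ℝ (Fin d)) (t₀ : I)
    (b : OrthonormalBasis (Fin d) ℝ (EuclideanSpace ℝ (Fin d))) (i : Fin d) (s : I) :
    EuclideanSpace ℝ (Fin d) :=
  (∫ ω, inner ℝ (b i) (X t₀ ω) * inner ℝ (b i) (X t₀ ω) ∂P)⁻¹ •
    ∫ ω, inner ℝ (b i) (X t₀ ω) • X s ω ∂P

/-- The residual of the linear regression of `X s` on `X t₀`, with `b` as in
`regressionCoeff`. -/
noncomputable def regressionResidual (P : Measure Ω) (X : I → Ω → EuclideanSpace ℝ (Fin d))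
    (t₀ : I) (b : OrthonormalBasis (Fin d) ℝ (EuclideanSpace ℝ (Fin d))) (s : I) (ω : Ω) :
    EuclideanSpace ℝ (Fin d) :=
  X s ω - ∑ i, inner ℝ (b i) (X t₀ ω) • regressionCoeff P X t₀ b i s

variable {X : I → Ω → EuclideanSpace ℝ (Fin d)} {t₀ : I}
  {b : OrthonormalBasis (Fin d) ℝ (EuclideanSpace ℝ (Fin d))}

theorem IsCentredGaussianField.memLp_two (hX : IsCentredGaussianField P X) (t : I) :
    MemLp (X t) 2 P :=
  (hX.gaussian.hasGaussianLaw_eval t).memLp_two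

/-- Measurability of the residual as a functional of the whole path of `X`. -/
theorem measurable_path_residual (P : Measure Ω) (X : I → Ω → EuclideanSpace ℝ (Fin d)) (t₀ : I)
    (b : OrthonormalBasis (Fin d) ℝ (EuclideanSpace ℝ (Fin d))) :
    Measurable fun (x : I → EuclideanSpace ℝ (Fin d)) (s : I) =>
      x s - ∑ i, inner ℝ (b i) (x t₀) • regressionCoeff P X t₀ b i s := by
  refine measurable_pi_lambda _ fun s => ?_
  refine (measurable_pi_apply s).sub (Finset.measurable_sum _ fun i _ => ?_)
  exact ((measurable_pi_apply t₀).const_inner (c := b i)).smul_const _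

theorem measurable_regressionResidual (hX : IsCentredGaussianField P X) (s : I) :
    Measurable (regressionResidual P X t₀ b s) := by
  refine (hX.measurable s).sub (Finset.measurable_sum _ fun i _ => ?_)
  exact ((hX.measurable t₀).const_inner (c := b i)).smul_const _

theorem integral_inner_eq_zero (hX : IsCentredGaussianField P X) (t : I)
    (u : EuclideanSpace ℝ (Fin d)) : ∫ ω, inner ℝ u (X t ω) ∂P = 0 := by
  rw [integral_inner (hX.gaussian.hasGaussianLaw_eval t).integrable, hX.centred, inner_zero_right]

variable [IsProbabilityMeasure P]

theorem covariance_inner_inner_eq_integral (hX : IsCentredGaussianField P X) (t : I)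
    (u v : EuclideanSpace ℝ (Fin d)) :
    cov[fun ω => inner ℝ u (X t ω), fun ω => inner ℝ v (X t ω); P] =
      ∫ ω, inner ℝ u (X t ω) * inner ℝ v (X t ω) ∂P := by
  rw [covariance_eq_sub ((hX.memLp_two t).const_inner u) ((hX.memLp_two t).const_inner v),
    integral_inner_eq_zero hX, zero_mul, sub_zero]
  rfl

theorem iIndepFun_inner_orthonormalBasis (hX : IsCentredGaussianField P X)
    (hb : ∀ i j, i ≠ j → ∫ ω, inner ℝ (b i) (X t₀ ω) * inner ℝ (b j) (X t₀ ω) ∂P = 0) :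
    iIndepFun (fun i ω => inner ℝ (b i) (X t₀ ω)) P := by
  refine HasGaussianLaw.iIndepFun_of_covariance_eq_zero ?_ fun i j hij => ?_
  · exact (hX.gaussian.hasGaussianLaw_eval t₀).map_fun
      (ContinuousLinearMap.pi fun i => innerSL ℝ (b i))
  · rw [covariance_inner_inner_eq_integral hX, hb i j hij]

theorem map_inner_eq_gaussianReal (hX : IsCentredGaussianField P X) (t : I)
    (u : EuclideanSpace ℝ (Fin d)) :
    P.map (fun ω => inner ℝ u (X t ω)) =
      gaussianReal 0 (∫ ω, inner ℝ u (X t ω) * inner ℝ u (X t ω) ∂P).toNNReal := by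
  have h : HasGaussianLaw (fun ω => inner ℝ u (X t ω)) P :=
    (hX.gaussian.hasGaussianLaw_eval t).map_fun (innerSL ℝ u)
  rw [h.map_eq_gaussianReal, integral_inner_eq_zero hX, ← covariance_self h.aemeasurable,
    covariance_inner_inner_eq_integral hX]

/-- The residual process is independent of `X t₀`: both are jointly Gaussian and uncorrelated. -/
theorem indepFun_regressionResidual (hX : IsCentredGaussianField P X)
    (hb : ∀ i j, i ≠ j → ∫ ω, inner ℝ (b i) (X t₀ ω) * inner ℝ (b j) (X t₀ ω) ∂P = 0)
    (hpos : ∀ i, 0 < ∫ ω, inner ℝ (b i) (X t₀ ω) * inner ℝ (b i) (X t₀ ω) ∂P) :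
    IndepFun (X t₀) (fun ω s => regressionResidual P X t₀ b s ω) P := by
  classical
  have hG : IsGaussianProcess
      (Sum.elim (fun _ : Unit => X t₀) (regressionResidual P X t₀ b)) P := by
    refine hX.gaussian.of_isGaussianProcess ?_
    rintro (u | s)
    · exact ⟨{t₀}, ContinuousLinearMap.proj ⟨t₀, by simp⟩, fun ω => rfl⟩
    · let pr : ({s, t₀} : Finset I) →
          ((({s, t₀} : Finset I) → EuclideanSpace ℝ (Fin d)) →L[ℝ] EuclideanSpace ℝ (Fin d)) :=
        fun u => ContinuousLinearMap.proj u
      refine ⟨{s, t₀}, pr ⟨s, by simp⟩ - ∑ i, ((innerSL ℝ (b i)).comp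
        (pr ⟨t₀, by simp⟩)).smulRight (regressionCoeff P X t₀ b i s), fun ω => ?_⟩
      simp [pr, regressionResidual, Finset.restrict_def]
  have hcov : ∀ s i y, ∫ ω, inner ℝ (b i) (X t₀ ω) *
      inner ℝ y (regressionResidual P X t₀ b s ω) ∂P = 0 := by
    intro s i y
    have h1 : ∀ ω, inner ℝ (b i) (X t₀ ω) * inner ℝ y (regressionResidual P X t₀ b s ω) =
        inner ℝ (b i) (X t₀ ω) * inner ℝ y (X s ω) -
        ∑ j, (inner ℝ (b i) (X t₀ ω) * inner ℝ (b j) (X t₀ ω)) *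
          inner ℝ y (regressionCoeff P X t₀ b j s) := by
      intro ω
      rw [regressionResidual, inner_sub_right, inner_sum, mul_sub, Finset.mul_sum]
      simp only [inner_smul_right, mul_assoc]
    have hint := fun j => (integrable_inner_mul_inner (hX.memLp_two t₀) (hX.memLp_two t₀)
      (b i) (b j)).mul_const (inner ℝ y (regressionCoeff P X t₀ b j s))
    simp only [h1]
    rw [integral_sub (integrable_inner_mul_inner (hX.memLp_two t₀) (hX.memLp_two s) _ _)
      (integrable_finsetSum _ fun j _ => hint j), integral_finsetSum _ fun j _ => hint j]
    simp only [integral_mul_const]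
    rw [Finset.sum_eq_single i (fun j _ hj => by rw [hb i j (Ne.symm hj), zero_mul])
      (by simp), regressionCoeff, inner_smul_right, mul_inv_cancel_left₀ (hpos i).ne',
      ← integral_inner (integrable_inner_smul (hX.memLp_two t₀) (hX.memLp_two s) _)]
    simp only [inner_smul_right, sub_self]
  have hres : ∀ s, MemLp (regressionResidual P X t₀ b s) 2 P := fun s =>
    (hG.hasGaussianLaw_eval (Sum.inr s)).memLp_two
  have hind := hG.indepFun_of_covariance_inner (fun _ => (hX.measurable t₀).aemeasurable)
    (fun s => (measurable_regressionResidual hX s).aemeasurable) fun _ s x y => by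
      rw [covariance_eq_sub ((hX.memLp_two t₀).const_inner x) ((hres s).const_inner y),
        integral_inner_eq_zero hX, zero_mul, sub_zero]
      have h2 : ∀ ω, inner ℝ x (X t₀ ω) = ∑ i, inner ℝ (b i) x * inner ℝ (b i) (X t₀ ω) := by
        intro ω
        rw [← b.sum_inner_mul_inner x]
        simp only [real_inner_comm]
      simp only [Pi.mul_apply, h2, Finset.sum_mul, mul_assoc]
      rw [integral_finsetSum _ fun i _ => (integrable_inner_mul_inner (hX.memLp_two t₀)
        (hres s) (b i) y).const_mul _]
      simp only [integral_const_mul, hcov, mul_zero, Finset.sum_const_zero]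
  exact hind.comp (measurable_pi_apply ()) measurable_id

end Regression

section ResidualEstimates

variable {N d : ℕ} {H : Fin N → ℝ} {Ω : Type*} [MeasurableSpace Ω] {P : Measure Ω}
  {I : Set (EuclideanSpace ℝ (Fin N))} {X : I → Ω → EuclideanSpace ℝ (Fin d)} {t₀ : I}
  {b : OrthonormalBasis (Fin d) ℝ (EuclideanSpace ℝ (Fin d))}

theorem norm_regressionCoeff_sub_le (hX : IsCentredGaussianField P X) {lam : ℝ} (hlam : 0 < lam)
    {i : Fin d} (hi : lam ≤ ∫ ω, inner ℝ (b i) (X t₀ ω) * inner ℝ (b i) (X t₀ ω) ∂P) (s t : I) :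
    ‖regressionCoeff P X t₀ b i s - regressionCoeff P X t₀ b i t‖ ≤
      (√lam)⁻¹ * √(∫ ω, ‖X s ω - X t ω‖ ^ 2 ∂P) := by
  have h₀ := hX.memLp_two t₀
  have hd : MemLp (fun ω => X s ω - X t ω) 2 P := (hX.memLp_two s).sub (hX.memLp_two t)
  set v := ∫ ω, inner ℝ (b i) (X t₀ ω) * inner ℝ (b i) (X t₀ ω) ∂P with hv
  have hvpos : 0 < v := hlam.trans_le hi
  set σ := √(∫ ω, ‖X s ω - X t ω‖ ^ 2 ∂P) with hσ
  have h1 : ‖∫ ω, inner ℝ (b i) (X t₀ ω) • (X s ω - X t ω) ∂P‖ ≤ √v * σ := by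
    have h2 : (2 : ENNReal) = ENNReal.ofReal 2 := by simp
    have hol := integral_mul_le_Lp_mul_Lq_of_nonneg (μ := P) Real.HolderConjugate.two_two
      (f := fun ω => ‖inner ℝ (b i) (X t₀ ω)‖) (g := fun ω => ‖X s ω - X t ω‖)
      (Filter.Eventually.of_forall fun _ => norm_nonneg _)
      (Filter.Eventually.of_forall fun _ => norm_nonneg _)
      (h2 ▸ (h₀.const_inner (b i)).norm) (h2 ▸ hd.norm)
    refine (norm_integral_le_integral_norm _).trans ?_
    simp only [norm_smul]
    refine hol.trans (le_of_eq ?_)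
    simp only [Real.rpow_two, ← Real.sqrt_eq_rpow, Real.norm_eq_abs, sq_abs]
    rw [hσ, hv]
    simp only [sq]
  have hsub : regressionCoeff P X t₀ b i s - regressionCoeff P X t₀ b i t =
      v⁻¹ • ∫ ω, inner ℝ (b i) (X t₀ ω) • (X s ω - X t ω) ∂P := by
    simp only [smul_sub]
    rw [integral_sub (integrable_inner_smul h₀ (hX.memLp_two s) _)
      (integrable_inner_smul h₀ (hX.memLp_two t) _), smul_sub]
    rfl
  rw [hsub, norm_smul, Real.norm_of_nonneg (by positivity)]
  calc v⁻¹ * ‖∫ ω, inner ℝ (b i) (X t₀ ω) • (X s ω - X t ω) ∂P‖ ≤ v⁻¹ * (√v * σ) := by gcongr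
    _ = (√v)⁻¹ * σ := by
        rw [← mul_assoc]
        congr 1
        nth_rewrite 1 [← Real.mul_self_sqrt hvpos.le]
        field_simp
    _ ≤ _ := by gcongr

/-- Comparison of the increments of the regression part with the conditioning vector. -/
theorem norm_sum_inner_smul_regressionCoeff_sub_le (hX : IsCentredGaussianField P X) {lam c : ℝ}
    (hlam : 0 < lam)
    (hv : ∀ i, lam ≤ ∫ ω, inner ℝ (b i) (X t₀ ω) * inner ℝ (b i) (X t₀ ω) ∂P)
    (hc : ∀ s t : I, √(∫ ω, ‖X s ω - X t ω‖ ^ 2 ∂P) ≤ c * anisoDist H s t) (s t : I)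
    (x : EuclideanSpace ℝ (Fin d)) :
    ‖∑ i, inner ℝ (b i) x • (regressionCoeff P X t₀ b i s - regressionCoeff P X t₀ b i t)‖ ≤
      d * (√lam)⁻¹ * c * anisoDist H s t * ‖x‖ := by
  refine (norm_sum_le _ _).trans ?_
  calc _ ≤ ∑ _i : Fin d, ‖x‖ * ((√lam)⁻¹ * (c * anisoDist H s t)) := by
        refine Finset.sum_le_sum fun i _ => ?_
        rw [norm_smul]
        have h1 : ‖(inner ℝ (b i) x : ℝ)‖ ≤ ‖x‖ := by
          simpa [b.norm_eq_one] using norm_inner_le_norm (𝕜 := ℝ) (b i) x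
        have h2 := norm_regressionCoeff_sub_le hX hlam (hv i) s t
        have h3 := hc s t
        gcongr
        exact h2.trans (by gcongr)
    _ = _ := by
        simp only [Finset.sum_const, Finset.card_univ, Fintype.card_fin, nsmul_eq_mul]
        ring

theorem regressionResidual_sub (s t : I) (ω : Ω) :
    regressionResidual P X t₀ b s ω - regressionResidual P X t₀ b t ω = (X s ω - X t ω) -
      ∑ i, inner ℝ (b i) (X t₀ ω) •
        (regressionCoeff P X t₀ b i s - regressionCoeff P X t₀ b i t) := by
  simp only [regressionResidual, smul_sub, Finset.sum_sub_distrib]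
  abel

theorem continuous_regressionCoeff (hX : IsCentredGaussianField P X)
    (hH : ∀ j, 0 < H j ∧ H j ≤ 1) {lam c : ℝ} (hlam : 0 < lam)
    (hv : ∀ i, lam ≤ ∫ ω, inner ℝ (b i) (X t₀ ω) * inner ℝ (b i) (X t₀ ω) ∂P)
    (hc : ∀ s t : I, √(∫ ω, ‖X s ω - X t ω‖ ^ 2 ∂P) ≤ c * anisoDist H s t) (i : Fin d) :
    Continuous fun s : I => regressionCoeff P X t₀ b i s := by
  refine continuous_iff_continuousAt.2 fun t => ?_
  rw [ContinuousAt, tendsto_iff_norm_sub_tendsto_zero]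
  have hρ : Filter.Tendsto (fun s : I => (√lam)⁻¹ * (c * anisoDist H s t)) (nhds t) (nhds 0) := by
    have h1 : Continuous fun s : I => (√lam)⁻¹ * (c * anisoDist H s t) :=
      (((continuous_anisoDist hH t.1).comp continuous_subtype_val).const_mul c).const_mul _
    simpa [anisoDist_self hH] using h1.tendsto t
  refine squeeze_zero (fun _ => norm_nonneg _) (fun s => ?_) hρ
  refine (norm_regressionCoeff_sub_le hX hlam (hv i) s t).trans ?_
  have := hc s t
  gcongr

theorem continuous_regressionResidual (hX : IsCentredGaussianField P X)
    (hH : ∀ j, 0 < H j ∧ H j ≤ 1) {lam c : ℝ} (hlam : 0 < lam)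
    (hv : ∀ i, lam ≤ ∫ ω, inner ℝ (b i) (X t₀ ω) * inner ℝ (b i) (X t₀ ω) ∂P)
    (hc : ∀ s t : I, √(∫ ω, ‖X s ω - X t ω‖ ^ 2 ∂P) ≤ c * anisoDist H s t) {ω : Ω}
    (hω : Continuous fun t : I => X t ω) :
    Continuous fun s => regressionResidual P X t₀ b s ω := by
  have h := continuous_regressionCoeff hX hH hlam hv hc
  unfold regressionResidual
  fun_prop

theorem ENNReal.add_pow_le_two_pow_mul (x y : ENNReal) (p : ℕ) :
    (x + y) ^ p ≤ 2 ^ p * (x ^ p + y ^ p) := by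
  rcases le_total x y with h | h
  · calc (x + y) ^ p ≤ (2 * y) ^ p := by rw [two_mul]; gcongr
      _ = 2 ^ p * y ^ p := mul_pow _ _ _
      _ ≤ _ := by gcongr; exact le_add_self
  · calc (x + y) ^ p ≤ (2 * x) ^ p := by rw [two_mul]; gcongr
      _ = 2 ^ p * x ^ p := mul_pow _ _ _
      _ ≤ _ := by gcongr; exact le_self_add

variable [IsProbabilityMeasure P]

/-- The increments of the residual process satisfy the same moment bounds as those of `X`,
uniformly in the conditioning point. -/
theorem exists_lintegral_regressionResidual_sub_pow_le (hX : IsCentredGaussianField P X)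
    {lam Lam c : ℝ} (hlam : 0 < lam) (hc0 : 0 < c)
    (hc : ∀ s t : I, √(∫ ω, ‖X s ω - X t ω‖ ^ 2 ∂P) ≤ c * anisoDist H s t)
    (hLam : ∀ t, ∫ ω, ‖X t ω‖ ^ 2 ∂P ≤ Lam) {p : ℕ} (hp : p ≠ 0) :
    ∃ K : ℝ, 0 ≤ K ∧ ∀ (t₀ : I) (b : OrthonormalBasis (Fin d) ℝ (EuclideanSpace ℝ (Fin d))),
      (∀ i, lam ≤ ∫ ω, inner ℝ (b i) (X t₀ ω) * inner ℝ (b i) (X t₀ ω) ∂P) → ∀ s t : I,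
      ∫⁻ ω, ‖regressionResidual P X t₀ b s ω - regressionResidual P X t₀ b t ω‖ₑ ^ p ∂P ≤
        ENNReal.ofReal ((K * anisoDist H s t) ^ p) := by
  obtain ⟨C, hC0, hC⟩ := exists_lintegral_enorm_pow_le_of_hasGaussianLaw P d p
  set m : ℝ := d * (√lam)⁻¹ * √Lam with hm
  have hm0 : 0 ≤ m := by positivity
  refine ⟨4 * (1 + C) * c * (1 + m), by positivity, fun t₀ b hv s t => ?_⟩
  set ρ := anisoDist H s.1 t.1 with hρ
  have hρ0 : 0 ≤ ρ := anisoDist_nonneg _ _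
  have hinc : ∫⁻ ω, ‖X s ω - X t ω‖ₑ ^ p ∂P ≤ ENNReal.ofReal (C * (c * ρ) ^ p) := by
    refine hC (fun ω => X s ω - X t ω) (c * ρ) hX.gaussian.hasGaussianLaw_fun_sub ?_
      (by positivity) ?_
    · rw [integral_sub (hX.gaussian.hasGaussianLaw_eval s).integrable
        (hX.gaussian.hasGaussianLaw_eval t).integrable, hX.centred, hX.centred, sub_zero]
    · exact (Real.sqrt_le_left (by positivity)).1 (hc s t)
  have hG : ∫⁻ ω, ‖X t₀ ω‖ₑ ^ p ∂P ≤ ENNReal.ofReal (C * √Lam ^ p) := by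
    refine hC (X t₀) (√Lam) (hX.gaussian.hasGaussianLaw_eval t₀) (hX.centred t₀)
      (Real.sqrt_nonneg _) ?_
    rw [Real.sq_sqrt (le_trans (integral_nonneg fun _ => by positivity) (hLam t₀))]
    exact hLam t₀
  set κ : ℝ := d * (√lam)⁻¹ * c * ρ with hκ
  have hκ0 : 0 ≤ κ := by positivity
  have hpt : ∀ ω, ‖regressionResidual P X t₀ b s ω - regressionResidual P X t₀ b t ω‖ₑ ^ p ≤
      2 ^ p * (‖X s ω - X t ω‖ₑ ^ p + ENNReal.ofReal (κ ^ p) * ‖X t₀ ω‖ₑ ^ p) := by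
    intro ω
    rw [ENNReal.ofReal_pow hκ0, ← mul_pow]
    refine le_trans ?_ (ENNReal.add_pow_le_two_pow_mul _ _ p)
    gcongr
    rw [regressionResidual_sub]
    refine (enorm_sub_le).trans ?_
    gcongr
    rw [← ofReal_norm, ← ofReal_norm, ← ENNReal.ofReal_mul hκ0]
    exact ENNReal.ofReal_le_ofReal
      (norm_sum_inner_smul_regressionCoeff_sub_le hX hlam hv hc s t _)
  have hms := hX.measurable s
  have hmt := hX.measurable t
  have hm0' := hX.measurable t₀
  calc _ ≤ ∫⁻ ω, 2 ^ p * (‖X s ω - X t ω‖ₑ ^ p +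
        ENNReal.ofReal (κ ^ p) * ‖X t₀ ω‖ₑ ^ p) ∂P := lintegral_mono hpt
    _ = 2 ^ p * (∫⁻ ω, ‖X s ω - X t ω‖ₑ ^ p ∂P +
        ENNReal.ofReal (κ ^ p) * ∫⁻ ω, ‖X t₀ ω‖ₑ ^ p ∂P) := by
        rw [lintegral_const_mul _ (by fun_prop), lintegral_add_left (by fun_prop),
          lintegral_const_mul _ (by fun_prop)]
    _ ≤ 2 ^ p * (ENNReal.ofReal (C * (c * ρ) ^ p) +
        ENNReal.ofReal (κ ^ p) * ENNReal.ofReal (C * √Lam ^ p)) := by gcongr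
    _ = ENNReal.ofReal (2 ^ p * (C * (c * ρ) ^ p + κ ^ p * (C * √Lam ^ p))) := by
        rw [← ENNReal.ofReal_mul (by positivity), ← ENNReal.ofReal_add (by positivity)
          (by positivity), ENNReal.ofReal_mul (by positivity),
          ENNReal.ofReal_pow (zero_le_two : (0 : ℝ) ≤ 2), ENNReal.ofReal_ofNat]
    _ ≤ _ := by
        refine ENNReal.ofReal_le_ofReal ?_
        have h1 : κ ^ p * (C * √Lam ^ p) = C * (c * ρ) ^ p * m ^ p := by
          rw [hκ, hm]
          simp only [mul_pow]
          ring
        have h2 : C ≤ (1 + C) ^ p := (by linarith : C ≤ 1 + C).trans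
          (le_self_pow₀ (by linarith) hp)
        have h3 : 1 + m ^ p ≤ 2 ^ p * (1 + m) ^ p := by
          have h4 : (1 : ℝ) ≤ (1 + m) ^ p := one_le_pow₀ (by linarith)
          have h5 : m ^ p ≤ (1 + m) ^ p := by gcongr; linarith
          have h6 : (2 : ℝ) ≤ 2 ^ p := le_self_pow₀ (by norm_num) hp
          nlinarith
        calc _ = 2 ^ p * C * (c * ρ) ^ p * (1 + m ^ p) := by rw [h1]; ring
          _ ≤ 2 ^ p * (1 + C) ^ p * (c * ρ) ^ p * (2 ^ p * (1 + m) ^ p) := by gcongr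
          _ = (2 * 2 * (1 + C) * c * (1 + m) * ρ) ^ p := by simp only [mul_pow]; ring
          _ = _ := by norm_num

end ResidualEstimates

/-! ### Probability of hitting a small ball from a small box -/

/-- Conditioning on `(W, Y)`, for independent `G`, `W`, `Y`. -/
theorem measure_le_lintegral_of_indepFun {Ω α β γ : Type*} [MeasurableSpace Ω]
    [MeasurableSpace α] [MeasurableSpace β] [MeasurableSpace γ] {P : Measure Ω}
    [IsProbabilityMeasure P] {G : Ω → α} {W : Ω → β} {Y : Ω → γ} (hG : Measurable G)
    (hW : Measurable W) (hY : Measurable Y) (hGW : IndepFun G W P)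
    (hGWY : IndepFun (fun ω => (G ω, W ω)) Y P) {A : Set ((α × β) × γ)} (hA : MeasurableSet A)
    {φ : β → ENNReal} (hφ : Measurable φ) (h : ∀ w y, P {ω | ((G ω, w), y) ∈ A} ≤ φ w) :
    P {ω | ((G ω, W ω), Y ω) ∈ A} ≤ ∫⁻ ω, φ (W ω) ∂P := by
  have hmG := Measure.isProbabilityMeasure_map (μ := P) hG.aemeasurable
  have hmW := Measure.isProbabilityMeasure_map (μ := P) hW.aemeasurable
  have hmY := Measure.isProbabilityMeasure_map (μ := P) hY.aemeasurable
  have h1 : P.map (fun ω => ((G ω, W ω), Y ω)) =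
      ((P.map G).prod (P.map W)).prod (P.map Y) := by
    rw [(indepFun_iff_map_prod_eq_prod_map_map (hG.prodMk hW).aemeasurable hY.aemeasurable).1
      hGWY, (indepFun_iff_map_prod_eq_prod_map_map hG.aemeasurable hW.aemeasurable).1 hGW]
  have h2 : P {ω | ((G ω, W ω), Y ω) ∈ A} = P.map (fun ω => ((G ω, W ω), Y ω)) A := by
    rw [Measure.map_apply ((hG.prodMk hW).prodMk hY) hA]; rfl
  rw [h2, h1, Measure.prod_apply_symm hA]
  calc _ ≤ ∫⁻ _y, ∫⁻ w, φ w ∂(P.map W) ∂(P.map Y) := by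
        refine lintegral_mono fun y => ?_
        have hAy : MeasurableSet ((fun x => (x, y)) ⁻¹' A) := measurable_prodMk_right hA
        rw [Measure.prod_apply_symm hAy]
        refine lintegral_mono fun w => ?_
        rw [Measure.map_apply hG (measurable_prodMk_right hAy)]
        exact h w y
    _ = _ := by
        rw [lintegral_const, measure_univ, mul_one, lintegral_map hφ hW]

section Hitting

variable {N d : ℕ} {H : Fin N → ℝ} {Ω : Type*} [MeasurableSpace Ω] {P : Measure Ω}
  {I : Set (EuclideanSpace ℝ (Fin N))} {X : I → Ω → EuclideanSpace ℝ (Fin d)}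

/-- Moment bound for the radius `a * r + 2 * W ^ (1 / p)` when `W` has mean of order `r ^ p`. -/
theorem lintegral_ofReal_add_rpow_pow_le [IsProbabilityMeasure P] {p : ℕ} (hp : p ≠ 0)
    (hdp : d ≤ p) {K a B r : ℝ}
    (hK : 0 ≤ K) (ha : 0 ≤ a) (hB : 0 ≤ B) (hr : 0 < r) {W : Ω → ENNReal} (hW : Measurable W)
    (hWB : ∫⁻ ω, W ω ∂P ≤ ENNReal.ofReal (B * r ^ p)) :
    ∫⁻ ω, ENNReal.ofReal (K * (a * r + 2 * (W ω).toReal ^ (1 / p : ℝ)) ^ d) ∂P ≤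
      ENNReal.ofReal (K * (2 ^ p * (1 + a) ^ p + 4 ^ p * B) * r ^ d) := by
  have hp' : (p : ℝ) ≠ 0 := by exact_mod_cast hp
  have hpt : ∀ w : ENNReal, ENNReal.ofReal (K * (a * r + 2 * w.toReal ^ (1 / p : ℝ)) ^ d) ≤
      ENNReal.ofReal (K * r ^ d * (2 ^ p * (1 + a) ^ p)) +
      ENNReal.ofReal (K * r ^ d * (4 ^ p / r ^ p)) * w := by
    intro w
    set q := w.toReal ^ (1 / p : ℝ) with hq
    have hq0 : 0 ≤ q := Real.rpow_nonneg ENNReal.toReal_nonneg _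
    have hqp : q ^ p = w.toReal := by
      rw [hq, ← Real.rpow_natCast, ← Real.rpow_mul ENNReal.toReal_nonneg,
        one_div_mul_cancel hp', Real.rpow_one]
    have h1 : (a * r + 2 * q) ^ d ≤ r ^ d * (2 ^ p * (1 + a) ^ p) +
        r ^ d * (4 ^ p / r ^ p) * w.toReal := by
      calc (a * r + 2 * q) ^ d = r ^ d * (a + 2 * (q / r)) ^ d := by
            rw [← mul_pow]; congr 1; field_simp
        _ ≤ r ^ d * ((1 + a) + 2 * (q / r)) ^ p := by
            gcongr
            calc (a + 2 * (q / r)) ^ d ≤ ((1 + a) + 2 * (q / r)) ^ d := by gcongr; linarith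
              _ ≤ _ := pow_le_pow_right₀ (by
                have : 0 ≤ q / r := by positivity
                linarith) hdp
        _ ≤ r ^ d * (2 ^ p * ((1 + a) ^ p + (2 * (q / r)) ^ p)) := by
            gcongr
            refine (add_pow_le (by positivity) (by positivity) p).trans ?_
            gcongr
            · norm_num
            · omega
        _ = _ := by
            rw [← hqp, show (4 : ℝ) = 2 * 2 by norm_num]
            simp only [mul_pow, div_pow]
            ring
    calc _ ≤ ENNReal.ofReal (K * r ^ d * (2 ^ p * (1 + a) ^ p) +
          K * r ^ d * (4 ^ p / r ^ p) * w.toReal) := by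
          refine ENNReal.ofReal_le_ofReal ?_
          calc _ ≤ K * _ := mul_le_mul_of_nonneg_left h1 hK
            _ = _ := by ring
      _ = ENNReal.ofReal (K * r ^ d * (2 ^ p * (1 + a) ^ p)) +
          ENNReal.ofReal (K * r ^ d * (4 ^ p / r ^ p)) * ENNReal.ofReal w.toReal := by
          rw [ENNReal.ofReal_add (by positivity) (by positivity),
            ENNReal.ofReal_mul (p := K * r ^ d * (4 ^ p / r ^ p)) (by positivity)]
      _ ≤ _ := by
          gcongr
          exact ENNReal.ofReal_toReal_le
  calc _ ≤ ∫⁻ ω, (ENNReal.ofReal (K * r ^ d * (2 ^ p * (1 + a) ^ p)) +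
        ENNReal.ofReal (K * r ^ d * (4 ^ p / r ^ p)) * W ω) ∂P :=
        lintegral_mono fun ω => hpt (W ω)
    _ = ENNReal.ofReal (K * r ^ d * (2 ^ p * (1 + a) ^ p)) +
        ENNReal.ofReal (K * r ^ d * (4 ^ p / r ^ p)) * ∫⁻ ω, W ω ∂P := by
        rw [lintegral_add_left measurable_const, lintegral_const, measure_univ, mul_one,
          lintegral_const_mul _ hW]
    _ ≤ ENNReal.ofReal (K * r ^ d * (2 ^ p * (1 + a) ^ p)) +
        ENNReal.ofReal (K * r ^ d * (4 ^ p / r ^ p)) * ENNReal.ofReal (B * r ^ p) := by gcongr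
    _ = _ := by
        rw [← ENNReal.ofReal_mul (by positivity), ← ENNReal.ofReal_add (by positivity)
          (by positivity)]
        congr 1
        field_simp

/-- The variances of a field with dominated canonical metric over a bounded set are bounded. -/
theorem exists_integral_norm_sq_le (hX : IsCentredGaussianField P X)
    (hH : ∀ j, 0 < H j ∧ H j ≤ 1) (hI : Bornology.IsBounded I) {c : ℝ} (hc0 : 0 < c)
    (hc : ∀ s t : I, √(∫ ω, ‖X s ω - X t ω‖ ^ 2 ∂P) ≤ c * anisoDist H s t) :
    ∃ Lam : ℝ, ∀ t, ∫ ω, ‖X t ω‖ ^ 2 ∂P ≤ Lam := by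
  rcases isEmpty_or_nonempty I with hI0 | ⟨⟨t₁⟩⟩
  · exact ⟨0, fun t => (hI0.false t).elim⟩
  obtain ⟨D, hD⟩ : ∃ D : ℝ, ∀ s : I, anisoDist H s t₁ ≤ D := by
    have hcpt := hI.isCompact_closure
    obtain ⟨D, hD⟩ := hcpt.bddAbove_image (continuous_anisoDist hH t₁.1).continuousOn
    exact ⟨D, fun s => hD ⟨s, subset_closure s.2, rfl⟩⟩
  refine ⟨2 * (c * D) ^ 2 + 2 * ∫ ω, ‖X t₁ ω‖ ^ 2 ∂P, fun t => ?_⟩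
  have hi : ∀ {V : Ω → EuclideanSpace ℝ (Fin d)}, MemLp V 2 P →
      Integrable (fun ω => ‖V ω‖ ^ 2) P := fun hV => hV.integrable_norm_pow (by norm_num)
  have hd : Integrable (fun ω => ‖X t ω - X t₁ ω‖ ^ 2) P :=
    hi ((hX.memLp_two t).sub (hX.memLp_two t₁))
  have h1 : ∫ ω, ‖X t ω - X t₁ ω‖ ^ 2 ∂P ≤ (c * D) ^ 2 := by
    have h2 := hc t t₁
    have h3 := anisoDist_nonneg (H := H) t.1 t₁.1
    have h4 := hD t
    exact (Real.sqrt_le_left (mul_nonneg hc0.le (h3.trans h4))).1 (h2.trans (by gcongr))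
  calc ∫ ω, ‖X t ω‖ ^ 2 ∂P ≤ ∫ ω, (2 * ‖X t ω - X t₁ ω‖ ^ 2 + 2 * ‖X t₁ ω‖ ^ 2) ∂P := by
        refine integral_mono (hi (hX.memLp_two t))
          ((hd.const_mul 2).add ((hi (hX.memLp_two t₁)).const_mul 2)) fun ω => ?_
        have h5 : ‖X t ω‖ ≤ ‖X t ω - X t₁ ω‖ + ‖X t₁ ω‖ := by
          simpa using norm_add_le (X t ω - X t₁ ω) (X t₁ ω)
        have h6 := norm_nonneg (X t ω)
        change ‖X t ω‖ ^ 2 ≤ 2 * ‖X t ω - X t₁ ω‖ ^ 2 + 2 * ‖X t₁ ω‖ ^ 2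
        nlinarith [sq_nonneg (‖X t ω - X t₁ ω‖ - ‖X t₁ ω‖)]
    _ = 2 * ∫ ω, ‖X t ω - X t₁ ω‖ ^ 2 ∂P + 2 * ∫ ω, ‖X t₁ ω‖ ^ 2 ∂P := by
        rw [integral_add (hd.const_mul 2) ((hi (hX.memLp_two t₁)).const_mul 2),
          integral_const_mul, integral_const_mul]
    _ ≤ _ := by gcongr

/-- If `X + f` comes within `r` of `x` at a point `s` of the box of radius `r` around `t₀`, then
`X t₀` lies in a ball around `x - f t₀` whose radius is controlled by `‖X t₀‖` and a bound `w` for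
the oscillation of the residual. -/
theorem norm_add_le_of_hit (hX : IsCentredGaussianField P X) (hH : ∀ j, 0 < H j ∧ H j ≤ 1)
    {lam c L : ℝ} (hlam : 0 < lam) (hc0 : 0 < c) (hL : 0 ≤ L)
    (hc : ∀ s t : I, √(∫ ω, ‖X s ω - X t ω‖ ^ 2 ∂P) ≤ c * anisoDist H s t) {t₀ s : I}
    {b : OrthonormalBasis (Fin d) ℝ (EuclideanSpace ℝ (Fin d))}
    (hv : ∀ i, lam ≤ ∫ ω, inner ℝ (b i) (X t₀ ω) * inner ℝ (b i) (X t₀ ω) ∂P)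
    {r w : ℝ} (hr : 0 ≤ r) (hs : s.1 ∈ anisoBox H t₀ r) {ω : Ω}
    (hw : ‖regressionResidual P X t₀ b s ω - regressionResidual P X t₀ b t₀ ω‖ ≤ w)
    {f : I → EuclideanSpace ℝ (Fin d)} (hf : f ∈ lipAniso H I L) {x : EuclideanSpace ℝ (Fin d)}
    (hit : ‖X s ω + f s - x‖ ≤ r) :
    ‖X t₀ ω + (f t₀ - x)‖ ≤
      ((1 + N * L + d * (√lam)⁻¹ * c * N) * r + w) * (1 + ‖X t₀ ω‖) := by
  have hρ := anisoDist_le_of_mem_anisoBox hH hr hs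
  have h1 := norm_sum_inner_smul_regressionCoeff_sub_le hX hlam hv hc s t₀ (X t₀ ω)
  set R := regressionResidual P X t₀ b s ω - regressionResidual P X t₀ b t₀ ω with hR
  set A := ∑ i, inner ℝ (b i) (X t₀ ω) •
    (regressionCoeff P X t₀ b i s - regressionCoeff P X t₀ b i t₀) with hA
  have hid : X t₀ ω + (f t₀ - x) = (X s ω + f s - x) - R - A - (f s - f t₀) := by
    rw [hR, regressionResidual_sub, ← hA]; abel
  have h2 : ‖f s - f t₀‖ ≤ L * (N * r) := (hf s t₀).trans (by gcongr)
  have h3 : ‖A‖ ≤ d * (√lam)⁻¹ * c * (N * r) * ‖X t₀ ω‖ := h1.trans (by gcongr)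
  have h4 : ‖X t₀ ω + (f t₀ - x)‖ ≤ ‖X s ω + f s - x‖ + ‖R‖ + ‖A‖ + ‖f s - f t₀‖ := by
    rw [hid]
    refine (norm_sub_le _ _).trans ?_
    gcongr
    refine (norm_sub_le _ _).trans ?_
    gcongr
    exact norm_sub_le _ _
  have hw0 : 0 ≤ w := (norm_nonneg _).trans hw
  have hn := norm_nonneg (X t₀ ω)
  have hN : 0 ≤ L * (N * r) := by positivity
  have hM : 0 ≤ d * (√lam)⁻¹ * c * (N * r) := by positivity
  nlinarith [mul_nonneg hr hn, mul_nonneg hN hn, mul_nonneg hw0 hn]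

/-- The probability that `X + Y` hits a ball of radius `r` at some point of an anisotropic box of
radius `r` is of order `r ^ d`, uniformly in the ball, in the box and in `Y`. -/
theorem exists_measure_hit_ball_from_box_le [IsProbabilityMeasure P]
    (hX : IsCentredGaussianField P X)
    (hH : ∀ j, 0 < H j ∧ H j ≤ 1) (hI : Bornology.IsBounded I) (hd : 0 < d)
    (hcont : ∀ᵐ ω ∂P, Continuous (fun t : I => X t ω))
    (hmetric : CanonicalMetricDominated P H X) (heig : CovarianceBoundedBelow P X)
    {L : ℝ} (hL : 0 ≤ L) :
    ∃ C : ℝ, 0 < C ∧ ∀ Y : I → Ω → EuclideanSpace ℝ (Fin d), (∀ t, Measurable (Y t)) →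
      IndepFun (fun ω t => X t ω) (fun ω t => Y t ω) P →
      (∀ ω, (fun t => Y t ω) ∈ lipAniso H I L) →
      ∀ (t₀ : I) (r : ℝ), 0 < r → ∀ x : EuclideanSpace ℝ (Fin d),
      P {ω | ∃ s : I, s.1 ∈ anisoBox H t₀ r ∧ ‖X s ω + Y s ω - x‖ ≤ r} ≤
        ENNReal.ofReal (C * r ^ d) := by
  obtain ⟨c, hc0, hc⟩ := hmetric
  obtain ⟨lam, hlam, heig⟩ := heig
  obtain ⟨Lam, hLam⟩ := exists_integral_norm_sq_le hX hH hI hc0 hc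
  obtain ⟨K, hK0, hK⟩ := exists_measure_norm_add_le_mul_one_add_norm P hd hlam (Lam := Lam)
  obtain ⟨p, hpQ, hpd⟩ : ∃ p : ℕ, 4 * anisoQ H + 1 ≤ p ∧ d ≤ p := by
    obtain ⟨n, hn⟩ := exists_nat_ge (4 * anisoQ H + 1)
    exact ⟨max n d, hn.trans (by exact_mod_cast le_max_left n d), le_max_right _ _⟩
  have hp : p ≠ 0 := by omega
  have hp' : (p : ℝ) ≠ 0 := by exact_mod_cast hp
  obtain ⟨M, hM0, hM⟩ := exists_lintegral_regressionResidual_sub_pow_le hX hlam hc0 hc hLam hp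
  set a : ℝ := 1 + N * L + d * (√lam)⁻¹ * c * N with ha
  have ha0 : 0 ≤ a := by positivity
  set B : ℝ := 2 * (25 ^ N * 4 ^ anisoQ H * (2 * N) ^ p) * M ^ p with hB
  have hB0 : 0 ≤ B := by positivity
  refine ⟨K * (2 ^ p * (1 + a) ^ p + 4 ^ p * B), by positivity,
    fun Y hY hXY hYL t₀ r hr x => ?_⟩
  obtain ⟨b, hb⟩ := exists_orthonormalBasis_integral_inner_mul_inner_eq_zero (hX.memLp_two t₀)
  have hv : ∀ i, lam ≤ ∫ ω, inner ℝ (b i) (X t₀ ω) * inner ℝ (b i) (X t₀ ω) ∂P := by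
    intro i
    refine (heig t₀ (b i) (b.norm_eq_one i)).trans (le_of_eq ?_)
    congr 1
    ext ω
    rw [← sq, PiLp.inner_apply]
    simp [mul_comm]
  have hpos := fun i => hlam.trans_le (hv i)
  have hv' : ∀ i, ∫ ω, inner ℝ (b i) (X t₀ ω) * inner ℝ (b i) (X t₀ ω) ∂P ≤ Lam := by
    intro i
    refine le_trans (integral_mono (integrable_inner_mul_inner (hX.memLp_two t₀)
      (hX.memLp_two t₀) _ _) ((hX.memLp_two t₀).integrable_norm_pow (by norm_num))
      fun ω => ?_) (hLam t₀)
    have h1 : |inner ℝ (b i) (X t₀ ω)| ≤ ‖X t₀ ω‖ := by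
      simpa [b.norm_eq_one] using abs_real_inner_le_norm (b i) (X t₀ ω)
    change inner ℝ (b i) (X t₀ ω) * inner ℝ (b i) (X t₀ ω) ≤ ‖X t₀ ω‖ ^ 2
    rw [← sq, ← sq_abs]
    gcongr
  obtain ⟨Φ, hΦm, hΦ, hΦP⟩ := exists_chaining_functional (d := d) hH P hpQ t₀ hr
  set R := regressionResidual P X t₀ b with hR
  have hRm : ∀ s, Measurable (R s) := measurable_regressionResidual hX
  set W : Ω → ENNReal := fun ω => Φ fun s => R s ω with hW
  have hWm : Measurable W := hΦm.comp (measurable_pi_lambda _ hRm)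
  have hWB : ∫⁻ ω, W ω ∂P ≤ ENNReal.ofReal (B * r ^ p) := by
    refine (hΦP R M hM0 hRm (hM t₀ b hv)).trans (le_of_eq ?_)
    congr 1
    rw [hB]; ring
  have hGW : IndepFun (X t₀) W P :=
    (indepFun_regressionResidual hX hb hpos).comp measurable_id hΦm
  have hGWY : IndepFun (fun ω => (X t₀ ω, W ω)) (Y t₀) P :=
    hXY.comp ((measurable_pi_apply t₀).prodMk
      (hΦm.comp (measurable_path_residual P X t₀ b))) (measurable_pi_apply t₀)
  set η : ENNReal → ℝ := fun w => a * r + 2 * w.toReal ^ (1 / p : ℝ) with hη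
  have hηm : Measurable η := by fun_prop
  have hη0 : ∀ w, 0 ≤ η w := fun w =>
    add_nonneg (by positivity) (mul_nonneg (by norm_num) (Real.rpow_nonneg ENNReal.toReal_nonneg _))
  set A : Set ((EuclideanSpace ℝ (Fin d) × ENNReal) × EuclideanSpace ℝ (Fin d)) :=
    {g | ‖g.1.1 + (g.2 - x)‖ ≤ η g.1.2 * (1 + ‖g.1.1‖)} with hA
  have hAm : MeasurableSet A := measurableSet_le (by fun_prop) (by fun_prop)
  have hmain : P {ω | ((X t₀ ω, W ω), Y t₀ ω) ∈ A} ≤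
      ENNReal.ofReal (K * (2 ^ p * (1 + a) ^ p + 4 ^ p * B) * r ^ d) := by
    refine (measure_le_lintegral_of_indepFun (hX.measurable t₀) hWm (hY t₀) hGW hGWY hAm
      (φ := fun w => ENNReal.ofReal (K * η w ^ d)) (by fun_prop) fun w y => ?_).trans
      (lintegral_ofReal_add_rpow_pow_le hp hpd hK0.le ha0 hB0 hr hWm hWB)
    exact hK b (X t₀) _ (fun i => by
        rw [Real.coe_toNNReal _ (hpos i).le]; exact ⟨hv i, hv' i⟩) (hX.measurable t₀)
      (fun i => map_inner_eq_gaussianReal hX t₀ (b i)) (iIndepFun_inner_orthonormalBasis hX hb)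
      (y - x) (η w) (hη0 w)
  refine le_trans (measure_mono_ae ?_) hmain
  have hfin : ∀ᵐ ω ∂P, W ω < ⊤ :=
    ae_lt_top hWm (hWB.trans_lt ENNReal.ofReal_lt_top).ne
  filter_upwards [hcont, hfin] with ω hω hWω
  rintro ⟨s, hs, hit⟩
  refine norm_add_le_of_hit hX hH hlam hc0 hL hc hv hr.le hs ?_ (hYL ω) hit
  have h1 := hΦ (fun s => R s ω) (continuous_regressionResidual hX hH hlam hv hc hω) s hs
  have h2 : ‖R s ω - R t₀ ω‖ ^ p ≤ (2 * (W ω).toReal ^ (1 / p : ℝ)) ^ p := by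
    have h3 := ENNReal.toReal_mono
      (ENNReal.mul_ne_top (ENNReal.pow_ne_top ENNReal.ofNat_ne_top) hWω.ne) h1
    rw [mul_pow, ← Real.rpow_natCast (_ ^ (1 / p : ℝ)), ← Real.rpow_mul ENNReal.toReal_nonneg,
      one_div_mul_cancel hp', Real.rpow_one]
    simpa using h3
  exact le_of_pow_le_pow_left₀ hp
    (mul_nonneg (by norm_num) (Real.rpow_nonneg ENNReal.toReal_nonneg _)) h2

end Hitting

/-! ### From balls to Hausdorff measure -/

theorem exists_subset_anisoBox {N : ℕ} {H : Fin N → ℝ} (hH : ∀ j, 0 < H j ∧ H j ≤ 1)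
    {I : Set (EuclideanSpace ℝ (Fin N))} (hI : Bornology.IsBounded I) :
    ∃ a : ℝ, 0 < a ∧ I ⊆ anisoBox H 0 a := by
  obtain ⟨B, hB⟩ := hI.exists_norm_le
  refine ⟨max 1 B, by positivity, fun s hs j => ?_⟩
  have h1 : |s j| ≤ ‖s‖ := PiLp.norm_apply_le s j
  calc |s j - (0 : EuclideanSpace ℝ (Fin N)) j| = |s j| := by simp
    _ ≤ max 1 B := h1.trans ((hB s hs).trans (le_max_right _ _))
    _ = max 1 B ^ (1 : ℝ) := (Real.rpow_one _).symm
    _ ≤ max 1 B ^ (1 / H j) := Real.rpow_le_rpow_of_exponent_le (le_max_left _ _)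
        ((one_le_div (hH j).1).2 (hH j).2)

/-- The probability that `X + Y` hits a ball of radius `r` is of order `r ^ (d - Q)`: the index
set is covered by `O(r ^ (-Q))` boxes of radius `r`. -/
theorem exists_measure_hit_closedBall_le {N d : ℕ} {H : Fin N → ℝ} {Ω : Type*}
    [MeasurableSpace Ω] {P : Measure Ω} [IsProbabilityMeasure P]
    {I : Set (EuclideanSpace ℝ (Fin N))} {X : I → Ω → EuclideanSpace ℝ (Fin d)}
    (hX : IsCentredGaussianField P X) (hH : ∀ j, 0 < H j ∧ H j ≤ 1)
    (hI : Bornology.IsBounded I) (hcont : ∀ᵐ ω ∂P, Continuous (fun t : I => X t ω))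
    (hmetric : CanonicalMetricDominated P H X) (heig : CovarianceBoundedBelow P X)
    (hQ : anisoQ H < (d : ℝ)) {L : ℝ} (hL : 0 ≤ L) :
    ∃ C : ℝ, 0 < C ∧ ∀ Y : I → Ω → EuclideanSpace ℝ (Fin d), (∀ t, Measurable (Y t)) →
      IndepFun (fun ω t => X t ω) (fun ω t => Y t ω) P →
      (∀ ω, (fun t => Y t ω) ∈ lipAniso H I L) →
      ∀ (x : EuclideanSpace ℝ (Fin d)) (r : ℝ), 0 < r →
      P {ω | ∃ s : I, X s ω + Y s ω ∈ Metric.closedBall x r} ≤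
        ENNReal.ofReal (C * r ^ ((d : ℝ) - anisoQ H)) := by
  have hd : 0 < d := by
    have := (anisoQ_nonneg hH).trans_lt hQ
    exact_mod_cast this
  obtain ⟨C, hC0, hC⟩ :=
    exists_measure_hit_ball_from_box_le hX hH hI hd hcont hmetric heig hL
  obtain ⟨a, ha0, ha⟩ := exists_subset_anisoBox hH hI
  refine ⟨5 ^ N * a ^ anisoQ H * C + (a ^ ((d : ℝ) - anisoQ H))⁻¹, by positivity,
    fun Y hY hXY hYL x r hr => ?_⟩
  rcases lt_or_ge a r with har | hra
  · -- For balls larger than the index set the bound exceeds `1`.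
    refine prob_le_one.trans ?_
    rw [← ENNReal.ofReal_one]
    refine ENNReal.ofReal_le_ofReal ?_
    have h1 : a ^ ((d : ℝ) - anisoQ H) ≤ r ^ ((d : ℝ) - anisoQ H) :=
      Real.rpow_le_rpow ha0.le har.le (by linarith)
    have h2 : 0 < a ^ ((d : ℝ) - anisoQ H) := by positivity
    rw [add_mul, inv_mul_eq_div]
    have h3 := (one_le_div h2).2 h1
    have h4 : 0 ≤ 5 ^ N * a ^ anisoQ H * C * r ^ ((d : ℝ) - anisoQ H) := by positivity
    linarith
  obtain ⟨S, -, hScard, hS⟩ := exists_finset_card_le_cover_anisoBox hH 0 hr hra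
    (Set.univ : Set I) fun s _ => ha s.2
  calc P {ω | ∃ s : I, X s ω + Y s ω ∈ Metric.closedBall x r}
      ≤ P (⋃ t ∈ S, {ω | ∃ s : I, s.1 ∈ anisoBox H t r ∧ ‖X s ω + Y s ω - x‖ ≤ r}) := by
        refine measure_mono ?_
        rintro ω ⟨s, hs⟩
        obtain ⟨t, ht, hst⟩ := hS s (Set.mem_univ s)
        exact Set.mem_biUnion ht ⟨s, hst, mem_closedBall_iff_norm.1 hs⟩
    _ ≤ ∑ t ∈ S, P {ω | ∃ s : I, s.1 ∈ anisoBox H t r ∧ ‖X s ω + Y s ω - x‖ ≤ r} :=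
        measure_biUnion_finset_le _ _
    _ ≤ ∑ _t ∈ S, ENNReal.ofReal (C * r ^ d) :=
        Finset.sum_le_sum fun t _ => hC Y hY hXY hYL t r hr x
    _ = ENNReal.ofReal (S.card * (C * r ^ d)) := by
        rw [Finset.sum_const, nsmul_eq_mul, ENNReal.ofReal_mul (Nat.cast_nonneg _),
          ENNReal.ofReal_natCast]
    _ ≤ _ := by
        refine ENNReal.ofReal_le_ofReal ?_
        calc S.card * (C * r ^ d) ≤ 5 ^ N * (a / r) ^ anisoQ H * (C * r ^ d) := by gcongr
          _ = 5 ^ N * a ^ anisoQ H * C * r ^ ((d : ℝ) - anisoQ H) := by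
              rw [Real.div_rpow ha0.le hr.le, Real.rpow_sub hr, Real.rpow_natCast]
              ring
          _ ≤ _ := by
              gcongr
              exact le_add_of_nonneg_right (by positivity)

/-- If the probability of hitting a ball of radius `r` is at most `C * r ^ D`, then the probability
of hitting a set is at most `C` times its `D`-dimensional Hausdorff measure. -/
theorem measure_exists_mem_le_hausdorffMeasure {Ω ι E : Type*} [MeasurableSpace Ω]
    {P : Measure Ω} [MetricSpace E] [MeasurableSpace E] [BorelSpace E] {V : ι → Ω → E} {C D : ℝ}
    (hC : 0 < C) (hD : 0 < D)
    (h : ∀ x r, 0 < r → P {ω | ∃ s, V s ω ∈ Metric.closedBall x r} ≤ ENNReal.ofReal (C * r ^ D))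
    (F : Set E) :
    P {ω | ∃ s, V s ω ∈ F} ≤ ENNReal.ofReal C * Measure.hausdorffMeasure D F := by
  have hC' : ENNReal.ofReal C ≠ 0 := (ENNReal.ofReal_pos.2 hC).ne'
  rw [mul_comm, ← ENNReal.div_le_iff hC' ENNReal.ofReal_ne_top, Measure.hausdorffMeasure_apply]
  refine le_iSup₂_of_le 1 one_pos (le_iInf fun t => le_iInf fun hFt => le_iInf fun hdiam => ?_)
  rw [ENNReal.div_le_iff hC' ENNReal.ofReal_ne_top, mul_comm, ← ENNReal.tsum_mul_left]
  calc P {ω | ∃ s, V s ω ∈ F} ≤ P (⋃ n, {ω | ∃ s, V s ω ∈ t n}) := by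
        refine measure_mono ?_
        rintro ω ⟨s, hs⟩
        obtain ⟨n, hn⟩ := Set.mem_iUnion.1 (hFt hs)
        exact Set.mem_iUnion.2 ⟨n, s, hn⟩
    _ ≤ ∑' n, P {ω | ∃ s, V s ω ∈ t n} := measure_iUnion_le _
    _ ≤ _ := by
        refine ENNReal.tsum_le_tsum fun n => ?_
        rcases (t n).eq_empty_or_nonempty with hn | hn
        · simp [hn]
        rw [iSup_pos hn]
        obtain ⟨x, hx⟩ := hn
        have hfin : Metric.ediam (t n) ≠ ⊤ := ((hdiam n).trans_lt ENNReal.one_lt_top).ne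
        set δ := (Metric.ediam (t n)).toReal with hδ
        have hδ0 : 0 ≤ δ := ENNReal.toReal_nonneg
        -- The diameter may vanish, so the ball estimate is used for radii decreasing to it.
        have hr : ∀ r, δ < r → P {ω | ∃ s, V s ω ∈ t n} ≤ ENNReal.ofReal (C * r ^ D) := by
          intro r hr
          refine (measure_mono ?_).trans (h x r (hδ0.trans_lt hr))
          rintro ω ⟨s, hs⟩
          refine ⟨s, ?_⟩
          rw [Metric.mem_closedBall, dist_edist]
          exact (ENNReal.toReal_mono hfin (Metric.edist_le_ediam_of_mem hs hx)).trans hr.le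
        have hlim : Filter.Tendsto (fun r : ℝ => ENNReal.ofReal (C * r ^ D))
            (nhdsWithin δ (Set.Ioi δ)) (nhds (ENNReal.ofReal (C * δ ^ D))) := by
          have : Continuous fun r : ℝ => ENNReal.ofReal (C * r ^ D) :=
            ENNReal.continuous_ofReal.comp
              ((Real.continuous_rpow_const hD.le).const_mul C)
          exact (this.tendsto δ).mono_left nhdsWithin_le_nhds
        have hle := ge_of_tendsto hlim (Filter.eventually_of_mem self_mem_nhdsWithin hr)
        rwa [ENNReal.ofReal_mul hC.le, ← ENNReal.ofReal_rpow_of_nonneg hδ0 hD.le, hδ,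
          ENNReal.ofReal_toReal hfin] at hle

theorem theorem1 {N d : ℕ} {Ω : Type*} [MeasurableSpace Ω] (P : Measure Ω)
    [IsProbabilityMeasure P]
    (H : Fin N → ℝ) (hH : ∀ j, 0 < H j ∧ H j ≤ 1)
    (I : Set (EuclideanSpace ℝ (Fin N))) (hI : Bornology.IsBounded I)
    (X : I → Ω → EuclideanSpace ℝ (Fin d))
    (hX : IsCentredGaussianField P X)
    (hcont : ∀ᵐ ω ∂P, Continuous (fun t : I => X t ω))
    (hmetric : CanonicalMetricDominated P H X)
    (heig : CovarianceBoundedBelow P X)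
    (hQ : anisoQ H < (d : ℝ)) :
    (∀ L : ℝ, 0 ≤ L → ∃ C : ℝ, 0 < C ∧
      ∀ F : Set (EuclideanSpace ℝ (Fin d)), MeasurableSet F →
      ∀ Y : I → Ω → EuclideanSpace ℝ (Fin d),
        (∀ t, Measurable (Y t)) →
        IndepFun (fun ω t => X t ω) (fun ω t => Y t ω) P →
        (∀ ω, (fun t => Y t ω) ∈ lipAniso H I L) →
        P {ω | ∃ s : I, X s ω + Y s ω ∈ F} ≤
          ENNReal.ofReal C * Measure.hausdorffMeasure ((d : ℝ) - anisoQ H) F) ∧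
    (∀ F : Set (EuclideanSpace ℝ (Fin d)),
      Measure.hausdorffMeasure ((d : ℝ) - anisoQ H) F = 0 → IsPolarFor P X F) := by
  have hD : 0 < (d : ℝ) - anisoQ H := sub_pos.2 hQ
  have hhit : ∀ L : ℝ, 0 ≤ L → ∃ C : ℝ, 0 < C ∧
      ∀ (F : Set (EuclideanSpace ℝ (Fin d))) (Y : I → Ω → EuclideanSpace ℝ (Fin d)),
        (∀ t, Measurable (Y t)) →
        IndepFun (fun ω t => X t ω) (fun ω t => Y t ω) P →
        (∀ ω, (fun t => Y t ω) ∈ lipAniso H I L) →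
        P {ω | ∃ s : I, X s ω + Y s ω ∈ F} ≤
          ENNReal.ofReal C * Measure.hausdorffMeasure ((d : ℝ) - anisoQ H) F := by
    intro L hL
    obtain ⟨C, hC0, hC⟩ := exists_measure_hit_closedBall_le hX hH hI hcont hmetric heig hQ hL
    exact ⟨C, hC0, fun F Y hY hXY hYL => measure_exists_mem_le_hausdorffMeasure hC0 hD
      (V := fun s ω => X s ω + Y s ω) (hC Y hY hXY hYL) F⟩
  refine ⟨fun L hL => ?_, fun F hF => ?_⟩
  · obtain ⟨C, hC0, hC⟩ := hhit L hL
    exact ⟨C, hC0, fun F _ => hC F⟩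
  · obtain ⟨C, -, hC⟩ := hhit 0 le_rfl
    have h := hC F (fun _ _ => 0) (fun _ => measurable_const)
      (indepFun_const_right _ _) (fun ω s t => by simp)
    simpa [hF, IsPolarFor] using h
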